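/- Let $G$ be a finite group. An \emph{indexing system} $\mathcal O$ for $G$ assigns to every subgroup $K\le G$ a full, isomorphism-closed class $\mathcal O(K)$ of finite $K$-sets (the admissible ones) that contains all trivial $K$-sets, is closed under disjoint unions and finite limits, is compatible with restriction to subgroups and conjugation, and is closed under self-induction: if $K\le L$, $L/K\in\mathcal O(L)$ and $T\in\mathcal O(K)$, then $L\times_K T\in\mathcal O(L)$. Let $\mathcal Set^G_{\mathcal O}$ be the wide subcategory of finite $G$-sets consisting of the maps $f\colon S\to T$ with $G_{f(s)}/G_s\in\mathcal O(G_{f(s)})$ for all $s\in S$. Let $\mathcal P^G_{\mathcal O}$ be the category whose objects are finite $G$-sets and whose morphisms $X\to Y$ are isomorphism classes (isomorphisms being the identity on $X$ and $Y$) of bispans $X\leftarrow A\xrightarrow{g} B\to Y$ of finite $G$-sets with $g\in\mathcal Set^G_{\mathcal O}$, with the usual composition of polynomials by pullback and dependent product. An \emph{$\mathcal O$-Tambara functor} is a finite-product-preserving functor $R\colon\mathcal P^G_{\mathcal O}\to\mathcal Set$ for which each commutative monoid $R(X)$, with addition $R(X)\times R(X)\cong R(X\amalg X)\to R(X)$ given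 by the transfer along the fold map, is a group; morphisms are natural transformations. Let $H\le G$ be a subgroup, and let $i_H^*\mathcal O$ be the indexing system for $H$ given by $(i_H^*\mathcal O)(K)=\mathcal O(K)$ for $K\le H$. Induction $T\mapsto G\times_H T$ and restriction $T\mapsto i_H^*T$ of finite sets with group action induce, by applying them to bispans, product-preserving functors $\mathcal P^H_{i_H^*\mathcal O}\to\mathcal P^G_{\mathcal O}$ and $\mathcal P^G_{\mathcal O}\to\mathcal P^H_{i_H^*\mathcal O}$. Let $i_H^*$ be the functor from $\mathcal O$-Tambara functors for $G$ to $i_H^*\mathcal O$-Tambara functors for $H$ given by precomposition with the first, so that $(i_H^*R)(T)=R(G\times_H T)$, and let $\mathrm{CoInd}_H^G$ be the functor from $i_H^*\mathcal O$-Tambara functors for $H$ to $\mathcal O$-Tambara functors for $G$ given by precomposition with the second, so that $$(\mathrm{CoInd}_H^G R)(T)=R(i_H^*T).$$ \textbf{Theorem.} For every finite group $G$, every subgroup $H\le G$ and every indexing system $\mathcal O$ for $G$, the functor $\mathrm{CoInd}_H^G$ is right adjoint to the restriction functor $i_H^*$. -/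

import Mathlib

open CategoryTheory CategoryTheory.Limits

universe u w

namespace IncompleteTambara

/-! ### Finite sets with an action of a group -/

/-- A finite `G`-set. Equivariant maps are Mathlib's `X →[G] Y`. -/
structure FinGSet (G : Type u) [Group G] : Type (u + 1) where
  carrier : Type u
  [action : MulAction G carrier]
  [finite : Finite carrier]

namespace FinGSet

instance (G : Type u) [Group G] : CoeSort (FinGSet.{u} G) (Type u) := ⟨FinGSet.carrier⟩

attribute [instance] FinGSet.action FinGSet.finite

section Basic

variable {G : Type u} [Group G]

/-- The empty `G`-set. -/
def empty (G : Type u) [Group G] : FinGSet.{u} G where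
  carrier := PEmpty.{u + 1}
  action := { smul := fun _ x => x, one_smul := fun _ => rfl, mul_smul := fun _ _ _ => rfl }

instance : IsEmpty (empty G) := inferInstanceAs (IsEmpty PEmpty.{u + 1})

/-- A finite set with trivial `G`-action. -/
def triv (G : Type u) [Group G] (X : Type u) [Finite X] : FinGSet.{u} G where
  carrier := X
  action := { smul := fun _ x => x, one_smul := fun _ => rfl, mul_smul := fun _ _ _ => rfl }

/-- The disjoint union of two finite `G`-sets. -/
def sum (X Y : FinGSet.{u} G) : FinGSet.{u} G where
  carrier := X ⊕ Y
  action :=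
    { smul := fun g => Sum.map (g • ·) (g • ·)
      one_smul := by
        rintro (x | x)
        · exact congrArg Sum.inl (one_smul G x)
        · exact congrArg Sum.inr (one_smul G x)
      mul_smul := by
        rintro g h (x | x)
        · exact congrArg Sum.inl (mul_smul g h x)
        · exact congrArg Sum.inr (mul_smul g h x) }
  finite := inferInstanceAs (Finite (X ⊕ Y))

/-- The first inclusion of a disjoint union. -/
def inl (X Y : FinGSet.{u} G) : X →[G] X.sum Y := ⟨Sum.inl, fun _ _ => rfl⟩

/-- The second inclusion of a disjoint union. -/
def inr (X Y : FinGSet.{u} G) : Y →[G] X.sum Y := ⟨Sum.inr, fun _ _ => rfl⟩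

/-- The map out of a disjoint union with given components. -/
def desc {X Y Z : FinGSet.{u} G} (f : X →[G] Z) (g : Y →[G] Z) : X.sum Y →[G] Z where
  toFun := Sum.elim f g
  map_smul' := by
    rintro k (x | x)
    · exact map_smul f k x
    · exact map_smul g k x

/-- The disjoint union of two maps. -/
def sumMap {X Y X' Y' : FinGSet.{u} G} (f : X →[G] X') (g : Y →[G] Y') :
    X.sum Y →[G] X'.sum Y' :=
  desc ((inl X' Y').comp f) ((inr X' Y').comp g)

/-- The fold map `X ⊔ X → X`. -/
def fold (X : FinGSet.{u} G) : X.sum X →[G] X := desc (MulActionHom.id G) (MulActionHom.id G)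

/-- The unique map out of the empty `G`-set. -/
def fromEmpty (X : FinGSet.{u} G) : empty G →[G] X := ⟨fun x => isEmptyElim x, fun _ x => isEmptyElim x⟩

/-- The maps `i`, `j` exhibit `Z` as the disjoint union of `X` and `Y`. -/
def IsCoprod {X Y Z : FinGSet.{u} G} (i : X →[G] Z) (j : Y →[G] Z) : Prop :=
  Function.Bijective (desc i j)

/-- A square of finite `G`-sets

```
  A --h--> B
  |f       |g
  C --k--> D
```

is a pullback: it commutes and `A` maps bijectively to the fibre product of `C` and `B` over `D`. -/
def IsPullbackSq {A B C D : FinGSet.{u} G} (f : A →[G] C) (h : A →[G] B) (k : C →[G] D)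
    (g : B →[G] D) : Prop :=
  (∀ a, k (f a) = g (h a)) ∧ ∀ c b, k c = g b → ∃! a, f a = c ∧ h a = b

/-- The `K`-set `K / (K ∩ L)`, for subgroups `K` and `L` of a finite group; it is the orbit `K / L`
when `L ≤ K`. -/
def quot [Finite G] (K L : Subgroup G) : FinGSet.{u} K where
  carrier := K ⧸ L.subgroupOf K
  finite := inferInstanceAs (Finite (K ⧸ L.subgroupOf K))

/-- The class of `k` in `K / (K ∩ L)`. -/
def quot.mk [Finite G] (K L : Subgroup G) (k : K) : quot K L :=
  Quotient.mk (QuotientGroup.leftRel (L.subgroupOf K)) k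

theorem quot.mk_eq [Finite G] {K L : Subgroup G} {a b : K} :
    quot.mk K L a = quot.mk K L b ↔ (a : G)⁻¹ * b ∈ L := by
  refine Quotient.eq.trans ?_
  rw [QuotientGroup.leftRel_apply, Subgroup.mem_subgroupOf]
  rfl

end Basic

section Change

variable {K L : Type u} [Group K] [Group L]

/-- The restriction of an `L`-set along a homomorphism `K → L`. -/
def pull (φ : K →* L) (T : FinGSet.{u} L) : FinGSet.{u} K where
  carrier := T.carrier
  action := MulAction.compHom T.carrier φ

/-- The restriction of an equivariant map. -/
def pullMap (φ : K →* L) {S T : FinGSet.{u} L} (f : S →[L] T) : S.pull φ →[K] T.pull φ where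
  toFun := fun s => f s
  map_smul' := fun k s => f.map_smul' (φ k) s

/-- The relation on `L × T` whose quotient is `L ×_K T`: it identifies `(l φ(k), t)` with
`(l, k t)`. -/
def indSetoid (φ : K →* L) (T : FinGSet.{u} K) : Setoid (L × T) where
  r x y := ∃ k : K, x.1 = y.1 * φ k ∧ y.2 = k • x.2
  iseqv :=
    { refl := fun x => ⟨1, by simp, by simp⟩
      symm := by
        rintro x y ⟨k, h1, h2⟩
        exact ⟨k⁻¹, by simp [h1], by simp [h2]⟩
      trans := by
        rintro x y z ⟨k, h1, h2⟩ ⟨k', h3, h4⟩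
        exact ⟨k' * k, by simp [h1, h3, mul_assoc], by simp [h4, h2, mul_smul]⟩ }

variable [Finite L]

/-- The induced `L`-set `L ×_K T`, for a homomorphism `K → L` (an inclusion of subgroups in all
uses below). -/
def ind (φ : K →* L) (T : FinGSet.{u} K) : FinGSet.{u} L where
  carrier := Quotient (indSetoid φ T)
  action :=
    { smul := fun l => Quotient.map (fun x => (l * x.1, x.2)) (by
        rintro x y ⟨k, h1, h2⟩
        exact ⟨k, by simp [h1, mul_assoc], h2⟩)
      one_smul := by
        rintro ⟨x⟩
        exact congrArg (Quotient.mk _) (Prod.ext (one_mul x.1) rfl)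
      mul_smul := by
        rintro l l' ⟨x⟩
        exact congrArg (Quotient.mk _) (Prod.ext (mul_assoc l l' x.1) rfl) }
  finite := inferInstanceAs (Finite (Quotient (indSetoid φ T)))

/-- The class of `(l, t)` in `L ×_K T`. -/
def ind.mk (φ : K →* L) {T : FinGSet.{u} K} (l : L) (t : T) : T.ind φ :=
  Quotient.mk (indSetoid φ T) (l, t)

/-- The map `L ×_K S → L ×_K T` induced by a `K`-map `S → T`. -/
def indMap (φ : K →* L) {S T : FinGSet.{u} K} (f : S →[K] T) : S.ind φ →[L] T.ind φ where
  toFun := Quotient.map (fun x => (x.1, f x.2)) (by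
    rintro x y ⟨k, h1, h2⟩
    exact ⟨k, h1, by simp [h2]⟩)
  map_smul' := by
    rintro l ⟨x⟩
    rfl

namespace ind

variable (φ : K →* L) {S T : FinGSet.{u} K}

theorem ind_mk (x : T.ind φ) : ∃ l t, x = mk φ l t := by
  obtain ⟨x⟩ := x
  exact ⟨x.1, x.2, rfl⟩

theorem smul_mk (l l' : L) (t : T) : l • mk φ l' t = mk φ (l * l') t := rfl

theorem map_mk (f : S →[K] T) (l : L) (s : S) : indMap φ f (mk φ l s) = mk φ l (f s) := rfl

theorem mk_eq {l l' : L} {t t' : T} :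
    mk φ l t = mk φ l' t' ↔ ∃ k : K, l = l' * φ k ∧ t' = k • t :=
  Quotient.eq (r := indSetoid φ T)

theorem mk_mul (l : L) (k : K) (t : T) : mk φ (l * φ k) t = mk φ l (k • t) :=
  (mk_eq φ).2 ⟨k, rfl, rfl⟩

variable {φ}

theorem mk_inj (hφ : Function.Injective φ) {l : L} {t t' : T} :
    mk φ l t = mk φ l t' ↔ t = t' := by
  refine ⟨fun h => ?_, fun h => by rw [h]⟩
  obtain ⟨k, h1, h2⟩ := (mk_eq φ).1 h
  have : k = 1 := hφ (by simpa using h1)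
  simpa [this] using h2.symm

theorem exists_of_map_eq {f : S →[K] T} {x : S.ind φ} {l : L} {t : T}
    (h : indMap φ f x = mk φ l t) : ∃ s, x = mk φ l s ∧ f s = t := by
  obtain ⟨l', s, rfl⟩ := ind_mk φ x
  obtain ⟨k, h1, h2⟩ := (mk_eq φ).1 h
  exact ⟨k • s, by rw [← mk_mul, ← show l' = l * φ k from h1], by rw [map_smul, h2]⟩

end ind

end Change

end FinGSet

open FinGSet
/-! ### Indexing systems -/

/-- The homomorphism `L → K`, `l ↦ g⁻¹ l g`, for subgroups with `g⁻¹ L g ≤ K`. -/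
def conjHom {G : Type u} [Group G] (K L : Subgroup G) (g : G) (h : ∀ l ∈ L, g⁻¹ * l * g ∈ K) :
    L →* K where
  toFun l := ⟨g⁻¹ * l * g, h l l.2⟩
  map_one' := Subtype.ext (by simp)
  map_mul' a b := Subtype.ext (by simp [mul_assoc])

/-- An indexing system for a finite group `G`: for every subgroup `K` a full subcategory of the
category of finite `K`-sets (the admissible `K`-sets), such that

* it is a sub coefficient system: it is preserved by the functors that the maps of the orbit
  category induce. The map `G/L → G/K`, `L ↦ gK`, exists if and only if `g⁻¹ L g ≤ K`, and it
  induces the restriction along `L → K`, `l ↦ g⁻¹ l g`;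
* it is symmetric monoidal, that is, closed under disjoint unions (the empty set is a trivial set);
* it contains all trivial sets;
* it is closed under finite limits, that is, under pullbacks (the one-point set is a trivial set);
* it is closed under self-induction.

Since a square whose horizontal maps are isomorphisms is a pullback, the subcategories are
replete. -/
structure IndexingSystem (G : Type u) [Group G] [Finite G] where
  adm : ∀ K : Subgroup G, FinGSet.{u} K → Prop
  restrict : ∀ (K L : Subgroup G) (g : G) (h : ∀ l ∈ L, g⁻¹ * l * g ∈ K) (T : FinGSet.{u} K),
    adm K T → adm L (T.pull (conjHom K L g h))
  sum : ∀ (K : Subgroup G) (S T : FinGSet.{u} K), adm K S → adm K T → adm K (S.sum T)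
  trivial : ∀ (K : Subgroup G) (T : FinGSet.{u} K), (∀ (k : K) (t : T), k • t = t) → adm K T
  pullback : ∀ (K : Subgroup G) {A B C D : FinGSet.{u} K} (f : A →[K] C) (h : A →[K] B)
    (k : C →[K] D) (g : B →[K] D), IsPullbackSq f h k g → adm K B → adm K C → adm K D → adm K A
  selfInd : ∀ (K H : Subgroup G) (hKH : K ≤ H), adm H (quot H K) →
    ∀ T : FinGSet.{u} K, adm K T → adm H (T.ind (Subgroup.inclusion hKH))

namespace IndexingSystem

variable {G : Type u} [Group G]

section

variable [Finite G] (O : IndexingSystem G)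

theorem adm_of_emb {K L : Subgroup G} (g : G) (h : ∀ l ∈ L, g⁻¹ * l * g ∈ K)
    {T : FinGSet.{u} K} {S : FinGSet.{u} L} (hT : O.adm K T) (j : S → T)
    (hj : Function.Injective j)
    (hj' : ∀ (l : L) (s : S), j (l • s) = conjHom K L g h l • j s) : O.adm L S := by
  have h1 := O.restrict K L g h T hT
  let j' : S →[L] T.pull (conjHom K L g h) := ⟨j, hj'⟩
  let k : T.pull (conjHom K L g h) →[L] triv L (ULift.{u} Prop) :=
    { toFun := fun t => ⟨t ∈ Set.range j⟩
      map_smul' := by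
        intro l t
        refine ULift.ext _ _ (propext ⟨?_, ?_⟩)
        · rintro ⟨s, hs⟩
          refine ⟨l⁻¹ • s, ?_⟩
          rw [hj', hs, map_inv]
          exact inv_smul_smul (conjHom K L g h l) (show T.carrier from t)
        · rintro ⟨s, hs⟩
          exact ⟨l • s, by rw [hj', hs]; rfl⟩ }
  let c : S →[L] triv L PUnit.{u + 1} := ⟨fun _ => PUnit.unit, fun _ _ => rfl⟩
  let d : triv L PUnit.{u + 1} →[L] triv L (ULift.{u} Prop) := ⟨fun _ => ⟨True⟩, fun _ _ => rfl⟩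
  refine O.pullback L c j' d k ⟨fun a => ?_, fun x b hb => ?_⟩ h1
    (O.trivial _ _ fun _ _ => rfl) (O.trivial _ _ fun _ _ => rfl)
  · exact ULift.ext _ _ (propext ⟨fun _ => ⟨a, rfl⟩, fun _ => True.intro⟩)
  · have hb' : b ∈ Set.range j := by
      have := congrArg ULift.down hb
      exact this.mp True.intro
    obtain ⟨s, hs⟩ := hb'
    exact ⟨s, ⟨rfl, hs⟩, fun s' hs' => hj (hs'.2.trans hs.symm)⟩

theorem adm_quot {K L : Subgroup G} (g : G) (h : ∀ l ∈ L, g⁻¹ * l * g ∈ K) {M N : Subgroup G}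
    (hMN : ∀ l ∈ L, l ∈ N ↔ g⁻¹ * l * g ∈ M) (hK : O.adm K (quot K M)) : O.adm L (quot L N) := by
  have key : ∀ a b : L, QuotientGroup.leftRel (N.subgroupOf L) a b ↔
      QuotientGroup.leftRel (M.subgroupOf K) (conjHom K L g h a) (conjHom K L g h b) := by
    intro a b
    rw [QuotientGroup.leftRel_apply, QuotientGroup.leftRel_apply, Subgroup.mem_subgroupOf,
      Subgroup.mem_subgroupOf, ← map_inv, ← map_mul]
    exact hMN _ (a⁻¹ * b).2
  refine O.adm_of_emb g h hK
    (Quotient.map (conjHom K L g h) fun a b hab => (key a b).1 hab) ?_ ?_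
  · rintro ⟨a⟩ ⟨b⟩ hab
    exact Quotient.sound ((key a b).2 (Quotient.exact hab))
  · rintro l ⟨a⟩
    exact congrArg (Quotient.mk _) (map_mul (conjHom K L g h) l a)

end

/-- The isomorphism of a subgroup `L` of `H` with the corresponding subgroup of `G`. -/
noncomputable def mapEquiv {H : Subgroup G} (L : Subgroup H) : L.map H.subtype ≃* L :=
  (L.equivMapOfInjective H.subtype H.subtype_injective).symm

theorem coe_mapEquiv {H : Subgroup G} (L : Subgroup H) (x : L.map H.subtype) :
    ((mapEquiv L x : H) : G) = x := by
  have := L.coe_equivMapOfInjective_apply H.subtype H.subtype_injective (mapEquiv L x)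
  simpa [mapEquiv] using this.symm

theorem coe_mapEquiv_symm {H : Subgroup G} (L : Subgroup H) (x : L) :
    (((mapEquiv L).symm x : L.map H.subtype) : G) = ((x : H) : G) := by
  simp [mapEquiv]

/-- A finite `L`-set, for `L ≤ H ≤ G`, where `L` is considered as a subgroup of `G`. -/
noncomputable def transport {H : Subgroup G} {L : Subgroup H} (T : FinGSet.{u} L) :
    FinGSet.{u} (L.map H.subtype) :=
  T.pull (mapEquiv L).toMonoidHom

variable [Finite G] (O : IndexingSystem G)

/-- The restriction `i_H^* O` of an indexing system to a subgroup `H`: a `K`-set, `K ≤ H`, is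
admissible for `i_H^* O` if and only if it is admissible for `O`. -/
noncomputable def res (H : Subgroup G) : IndexingSystem H where
  adm L T := O.adm (L.map H.subtype) (transport T)
  restrict K L g h T hT := by
    have h' : ∀ l ∈ L.map H.subtype, (g : G)⁻¹ * l * g ∈ K.map H.subtype := by
      rintro _ ⟨l, hl, rfl⟩
      exact ⟨g⁻¹ * l * g, h l hl, rfl⟩
    refine O.adm_of_emb (g : G) h' hT (fun t => t) (fun _ _ h => h) fun l t => ?_
    change (conjHom K L g h (mapEquiv L l)) • (show T.carrier from t) =
      (mapEquiv K (conjHom _ _ (g : G) h' l)) • (show T.carrier from t)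
    congr 1
    refine Subtype.ext (Subtype.ext ?_)
    rw [coe_mapEquiv]
    change (g : G)⁻¹ * ((mapEquiv L l : H) : G) * g = (g : G)⁻¹ * l * g
    rw [coe_mapEquiv]
  sum K S T hS hT := by
    refine O.adm_of_emb 1 (fun l hl => by simpa using hl) (O.sum _ _ _ hS hT) (fun t => t)
      (fun _ _ h => h) fun l t => ?_
    rw [show conjHom (K.map H.subtype) (K.map H.subtype) 1 (fun l hl => by simpa using hl) l = l
      from Subtype.ext (by simp [conjHom])]
    rcases t with t | t <;> rfl
  trivial K T hT := O.trivial _ _ fun k t => hT _ _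
  pullback K _ _ _ _ f h k g hsq hB hC hD :=
    O.pullback _ (pullMap (mapEquiv K).toMonoidHom f) (pullMap (mapEquiv K).toMonoidHom h)
      (pullMap (mapEquiv K).toMonoidHom k) (pullMap (mapEquiv K).toMonoidHom g) hsq hB hC hD
  selfInd K L hKL hL T hT := by
    have hle : K.map H.subtype ≤ L.map H.subtype := Subgroup.map_mono hKL
    have hq : O.adm (L.map H.subtype) (quot (L.map H.subtype) (K.map H.subtype)) := by
      have key : ∀ a b : L.map H.subtype,
          QuotientGroup.leftRel ((K.map H.subtype).subgroupOf (L.map H.subtype)) a b ↔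
          QuotientGroup.leftRel (K.subgroupOf L) (mapEquiv L a) (mapEquiv L b) := by
        intro a b
        rw [QuotientGroup.leftRel_apply, QuotientGroup.leftRel_apply, Subgroup.mem_subgroupOf,
          Subgroup.mem_subgroupOf, ← map_inv, ← map_mul, ← coe_mapEquiv L (a⁻¹ * b)]
        exact Subgroup.mem_map_iff_mem H.subtype_injective
      refine O.adm_of_emb 1 (fun l hl => by simpa using hl) hL
        (Quotient.map (mapEquiv L) fun a b hab => (key a b).1 hab) ?_ ?_
      · rintro ⟨a⟩ ⟨b⟩ hab
        exact Quotient.sound ((key a b).2 (Quotient.exact hab))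
      · rintro l ⟨a⟩
        refine congrArg (Quotient.mk _) ?_
        rw [show conjHom (L.map H.subtype) (L.map H.subtype) 1 (fun l hl => by simpa using hl) l = l
          from Subtype.ext (by simp [conjHom])]
        exact map_mul (mapEquiv L) l a
    have hind := O.selfInd _ _ hle hq _ hT
    have hcomp : ∀ k : K, (mapEquiv L).symm (Subgroup.inclusion hKL k) =
        Subgroup.inclusion hle ((mapEquiv K).symm k) := by
      intro k
      refine Subtype.ext ?_
      rw [coe_mapEquiv_symm]
      exact (coe_mapEquiv_symm K k).symm
    refine O.adm_of_emb 1 (fun l hl => by simpa using hl) hind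
      (Quotient.map (fun x => ((mapEquiv L).symm x.1, x.2)) ?_) ?_ ?_
    · rintro x y ⟨k, h1, h2⟩
      refine ⟨(mapEquiv K).symm k, ?_, ?_⟩
      · change (mapEquiv L).symm x.1 = (mapEquiv L).symm y.1 * _
        rw [h1, map_mul, hcomp]
      · refine h2.trans ?_
        change k • x.2 = (mapEquiv K ((mapEquiv K).symm k)) • x.2
        rw [MulEquiv.apply_symm_apply]
    · rintro ⟨x⟩ ⟨y⟩ hxy
      obtain ⟨k, h1, h2⟩ := Quotient.exact hxy
      refine Quotient.sound ⟨mapEquiv K k, ?_, h2⟩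
      refine (mapEquiv L).symm.injective ?_
      rw [map_mul, hcomp, MulEquiv.symm_apply_apply]
      exact h1
    · rintro l ⟨x⟩
      rw [show conjHom (L.map H.subtype) (L.map H.subtype) 1 (fun l hl => by simpa using hl) l = l
          from Subtype.ext (by simp [conjHom])]
      refine congrArg (Quotient.mk _) (Prod.ext ?_ rfl)
      change (mapEquiv L).symm (mapEquiv L l * x.1) = l * (mapEquiv L).symm x.1
      rw [map_mul, MulEquiv.symm_apply_apply]

theorem res_adm_quot (H : Subgroup G) (K L : Subgroup H) :
    (O.res H).adm K (quot K L) ↔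
      O.adm (K.map H.subtype) (quot (K.map H.subtype) (L.map H.subtype)) := by
  have key : ∀ a b : K.map H.subtype,
      QuotientGroup.leftRel ((L.map H.subtype).subgroupOf (K.map H.subtype)) a b ↔
      QuotientGroup.leftRel (L.subgroupOf K) (mapEquiv K a) (mapEquiv K b) := by
    intro a b
    rw [QuotientGroup.leftRel_apply, QuotientGroup.leftRel_apply, Subgroup.mem_subgroupOf,
      Subgroup.mem_subgroupOf, ← map_inv, ← map_mul, ← coe_mapEquiv K (a⁻¹ * b)]
    exact Subgroup.mem_map_iff_mem H.subtype_injective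
  have hone : ∀ l, conjHom (K.map H.subtype) (K.map H.subtype) 1 (fun l hl => by simpa using hl) l
      = l := fun l => Subtype.ext (by simp [conjHom])
  constructor
  · intro h
    refine O.adm_of_emb 1 (fun l hl => by simpa using hl) h
        (Quotient.map (mapEquiv K) fun a b hab => (key a b).1 hab) ?_ ?_
    · rintro ⟨a⟩ ⟨b⟩ hab
      exact Quotient.sound ((key a b).2 (Quotient.exact hab))
    · rintro l ⟨a⟩
      refine congrArg (Quotient.mk _) ?_
      rw [hone]
      exact map_mul (mapEquiv K) l a
  · intro h
    refine O.adm_of_emb 1 (fun l hl => by simpa using hl) h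
        (Quotient.map (mapEquiv K).symm fun a b hab => (key _ _).2 (by simpa using hab)) ?_ ?_
    · rintro ⟨a⟩ ⟨b⟩ hab
      have := (key _ _).1 (Quotient.exact hab)
      rw [MulEquiv.apply_symm_apply, MulEquiv.apply_symm_apply] at this
      exact Quotient.sound this
    · rintro l ⟨a⟩
      refine congrArg (Quotient.mk _) ?_
      rw [hone]
      change (mapEquiv K).symm (mapEquiv K l * a) = l * (mapEquiv K).symm a
      rw [map_mul, MulEquiv.symm_apply_apply]

end IndexingSystem

/-! ### Subcategories of exponents -/

/-- A wide, pullback stable, symmetric monoidal (for the disjoint union) subcategory of the category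
of finite `G`-sets. -/
structure Exponents (G : Type u) [Group G] where
  mem : ∀ {X Y : FinGSet.{u} G}, (X →[G] Y) → Prop
  id_mem : ∀ X : FinGSet.{u} G, mem (MulActionHom.id G : X →[G] X)
  comp_mem : ∀ {X Y Z : FinGSet.{u} G} (f : X →[G] Y) (g : Y →[G] Z), mem f → mem g →
    mem (g.comp f)
  pullback_mem : ∀ {A B C D : FinGSet.{u} G} (f : A →[G] C) (h : A →[G] B) (k : C →[G] D)
    (g : B →[G] D), IsPullbackSq f h k g → mem g → mem f
  sum_mem : ∀ {X Y X' Y' : FinGSet.{u} G} (f : X →[G] X') (g : Y →[G] Y'), mem f → mem g →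
    mem (sumMap f g)

open MulAction in
/-- The subcategory `Set^G_O` of the category of finite `G`-sets, for an indexing system `O`: it
contains a map `f : S → T` if and only if `G_{f(s)} / G_s` is an admissible `G_{f(s)}`-set for all
`s` in `S`. -/
def IndexingSystem.exponents {G : Type u} [Group G] [Finite G] (O : IndexingSystem G) :
    Exponents G where
  mem {S T} f := ∀ s : S, O.adm (stabilizer G (f s)) (quot (stabilizer G (f s)) (stabilizer G s))
  id_mem X x := by
    refine O.trivial _ _ ?_
    rintro k ⟨a⟩
    exact quot.mk_eq.2 ((stabilizer G x).mul_mem ((stabilizer G x).inv_mem (k * a).2) a.2)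
  comp_mem {X Y Z} f g hf hg x := by
    have hle : stabilizer G (f x) ≤ stabilizer G (g (f x)) := fun k hk => by
      rw [mem_stabilizer_iff] at hk ⊢
      rw [← map_smul, hk]
    have hle' : stabilizer G x ≤ stabilizer G (f x) := fun k hk => by
      rw [mem_stabilizer_iff] at hk ⊢
      rw [← map_smul, hk]
    have h := O.selfInd _ _ hle (hg (f x)) _ (hf x)
    refine O.adm_of_emb 1 (fun l hl => by simpa using hl) h
      (Quotient.lift (fun a => ind.mk (Subgroup.inclusion hle) a (quot.mk _ _ 1)) ?_) ?_ ?_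
    · intro a b hab
      replace hab := quot.mk_eq.1 (Quotient.sound hab)
      rw [ind.mk_eq]
      refine ⟨⟨(b : G)⁻¹ * a, hle' (by simpa using (stabilizer G x).inv_mem hab)⟩, ?_, ?_⟩
      · refine Subtype.ext ?_
        simp
      · refine quot.mk_eq.2 ?_
        simpa using (stabilizer G x).inv_mem hab
    · rintro ⟨a⟩ ⟨b⟩ hab
      obtain ⟨k, h1, h2⟩ := (ind.mk_eq _).1 hab
      refine quot.mk_eq.2 ?_
      replace h2 := quot.mk_eq.1 h2
      rw [h1]
      simpa using (stabilizer G x).inv_mem h2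
    · rintro l ⟨a⟩
      refine congrArg (Quotient.mk _) (Prod.ext (Subtype.ext ?_) rfl)
      change (l : G) * a = (1 : G)⁻¹ * l * 1 * a
      simp
  pullback_mem {A B C D} f h k g hsq hg a := by
    have hstab : ∀ l ∈ stabilizer G (f a), l ∈ stabilizer G (g (h a)) := fun l hl => by
      rw [mem_stabilizer_iff] at hl ⊢
      rw [← hsq.1, ← map_smul, hl]
    refine O.adm_quot 1 (fun l hl => by simpa using hstab l hl) (fun l hl => ?_) (hg (h a))
    have hl1 := hstab l hl
    rw [mem_stabilizer_iff] at hl hl1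
    simp only [inv_one, one_mul, mul_one, mem_stabilizer_iff]
    refine ⟨fun h1 => by rw [← map_smul, h1], fun h1 => ?_⟩
    obtain ⟨_, _, h2⟩ := hsq.2 (f a) (h a) (hsq.1 a)
    exact (h2 (l • a) ⟨by rw [map_smul, hl], by rw [map_smul, h1]⟩).trans
      (h2 a ⟨rfl, rfl⟩).symm
  sum_mem {X Y X' Y'} f g hf hg := by
    rintro (x | y)
    · have h1 : ∀ l : G, l ∈ stabilizer G (sumMap f g (Sum.inl x)) ↔ l ∈ stabilizer G (f x) :=
        fun l => Sum.inl_injective.eq_iff (a := l • f x) (b := f x)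
      refine O.adm_quot 1 (fun l hl => by simpa using (h1 l).1 hl) (fun l hl => ?_) (hf x)
      simp only [inv_one, one_mul, mul_one]
      exact Sum.inl_injective.eq_iff (a := l • x) (b := x)
    · have h1 : ∀ l : G, l ∈ stabilizer G (sumMap f g (Sum.inr y)) ↔ l ∈ stabilizer G (g y) :=
        fun l => Sum.inr_injective.eq_iff (a := l • g y) (b := g y)
      refine O.adm_quot 1 (fun l hl => by simpa using (h1 l).1 hl) (fun l hl => ?_) (hg y)
      simp only [inv_one, one_mul, mul_one]
      exact Sum.inr_injective.eq_iff (a := l • y) (b := y)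

/-! ### Polynomials -/

/-- A bispan `X ← A → B → Y` of finite `G`-sets. -/
structure Bispan {G : Type u} [Group G] (X Y : FinGSet.{u} G) where
  A : FinGSet.{u} G
  B : FinGSet.{u} G
  s : A →[G] X
  f : A →[G] B
  t : B →[G] Y

namespace Bispan

variable {G : Type u} [Group G] {W X Y Z : FinGSet.{u} G}

/-- An isomorphism of bispans, which is the identity on `X` and on `Y`. -/
structure Iso (p q : Bispan X Y) where
  eA : p.A ≃ q.A
  eB : p.B ≃ q.B
  smul_A : ∀ (g : G) (a : p.A), eA (g • a) = g • eA a
  smul_B : ∀ (g : G) (b : p.B), eB (g • b) = g • eB b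
  comm_s : ∀ a, q.s (eA a) = p.s a
  comm_f : ∀ a, q.f (eA a) = eB (p.f a)
  comm_t : ∀ b, q.t (eB b) = p.t b

/-- The identity isomorphism. -/
def Iso.refl (p : Bispan X Y) : Iso p p :=
  ⟨Equiv.refl _, Equiv.refl _, fun _ _ => rfl, fun _ _ => rfl, fun _ => rfl, fun _ => rfl,
    fun _ => rfl⟩

/-- The inverse of an isomorphism. -/
def Iso.symm {p q : Bispan X Y} (e : Iso p q) : Iso q p where
  eA := e.eA.symm
  eB := e.eB.symm
  smul_A g a := e.eA.injective (by simp [e.smul_A])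
  smul_B g a := e.eB.injective (by simp [e.smul_B])
  comm_s a := by simp [← e.comm_s]
  comm_f a := e.eB.injective (by simp [← e.comm_f])
  comm_t a := by simp [← e.comm_t]

/-- The composite of two isomorphisms. -/
def Iso.trans {p q r : Bispan X Y} (e : Iso p q) (e' : Iso q r) : Iso p r where
  eA := e.eA.trans e'.eA
  eB := e.eB.trans e'.eB
  smul_A g a := by simp [e.smul_A, e'.smul_A]
  smul_B g a := by simp [e.smul_B, e'.smul_B]
  comm_s a := by simp [e.comm_s, e'.comm_s]
  comm_f a := by simp [e.comm_f, e'.comm_f]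
  comm_t a := by simp [e.comm_t, e'.comm_t]

/-- The identity bispan. -/
def id (X : FinGSet.{u} G) : Bispan X X :=
  ⟨X, X, MulActionHom.id G, MulActionHom.id G, MulActionHom.id G⟩

/-- The bispan `R_j = [Y ← X = X = X]` of a map `j : X → Y`. -/
def R (j : X →[G] Y) : Bispan Y X :=
  ⟨X, X, j, MulActionHom.id G, MulActionHom.id G⟩

/-- The bispan `T_h = [X = X = X → Y]` of a map `h : X → Y`. -/
def T (h : X →[G] Y) : Bispan X Y :=
  ⟨X, X, MulActionHom.id G, MulActionHom.id G, h⟩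

/-! #### Composition

The composite of `X ← A → B → Y` and `Y ← C → D → Z` is formed from the pullback
`B' = B ×_Y C → C`, the dependent product `Q → D` of `B'` along `C → D` (its fibre over `d` is the
product of the fibres of `B' → C` over the points `c` over `d`), the evaluation map
`P = Q ×_D C → B' → B` and the pullback `A' = P ×_B A`. It is `X ← A' → P → Q → D → Z`. -/

/-- The dependent product in the composite: a point is a point `d` of `D`, and for every point `c`
of the fibre of `C → D` over `d` a point `σ c` of `B` with the same image in `Y`. -/
structure CompB (p : Bispan X Y) (q : Bispan Y Z) : Type u where
  d : q.B
  σ : ∀ c : q.A, q.f c = d → p.B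
  hσ : ∀ c h, p.t (σ c h) = q.s c

theorem CompB.ext' {p : Bispan X Y} {q : Bispan Y Z} {x y : CompB p q} (h : x.d = y.d)
    (h' : ∀ c h1 h2, x.σ c h1 = y.σ c h2) : x = y := by
  obtain ⟨d, σ, hσ⟩ := x
  obtain ⟨d', σ', hσ'⟩ := y
  obtain rfl : d = d' := h
  obtain rfl : σ = σ' := funext fun c => funext fun h => h' c h h
  rfl

/-- The `G`-set underlying the dependent product: `(g σ)(c) = g σ(g⁻¹ c)`. -/
def compB (p : Bispan X Y) (q : Bispan Y Z) : FinGSet.{u} G where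
  carrier := CompB p q
  action :=
    { smul := fun g x =>
        { d := g • x.d
          σ := fun c h => g • x.σ (g⁻¹ • c) (by rw [map_smul, h, inv_smul_smul])
          hσ := fun c h => by rw [map_smul, x.hσ, map_smul, smul_inv_smul] }
      one_smul := fun x => CompB.ext' (one_smul G x.d) fun c h1 h2 => by
        change (1 : G) • x.σ ((1 : G)⁻¹ • c) _ = _
        simp
      mul_smul := fun g h x => CompB.ext' (mul_smul g h x.d) fun c h1 h2 => by
        change (g * h) • x.σ ((g * h)⁻¹ • c) _ = g • h • x.σ (h⁻¹ • g⁻¹ • c) _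
        simp [mul_smul] }
  finite := by
    refine Finite.of_injective
      (β := Σ d : q.B, ({c : q.A // q.f c = d} → p.B)) (fun x => ⟨x.d, fun c => x.σ c.1 c.2⟩) ?_
    rintro ⟨d, σ, hσ⟩ ⟨d', σ', hσ'⟩ h
    obtain rfl : d = d' := congrArg Sigma.fst h
    refine CompB.ext' rfl fun c h1 h2 => ?_
    exact congrFun (eq_of_heq (Sigma.mk.inj h).2) ⟨c, h1⟩

/-- The fibre product `P` of `Q` and `C` over `D`. -/
def compP (p : Bispan X Y) (q : Bispan Y Z) : FinGSet.{u} G where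
  carrier := {x : compB p q × q.A // q.f x.2 = x.1.d}
  action :=
    { smul := fun g x => ⟨(g • x.1.1, g • x.1.2), by
        change q.f (g • x.1.2) = g • x.1.1.d
        rw [map_smul, x.2]⟩
      one_smul := fun x => Subtype.ext (one_smul G x.1)
      mul_smul := fun g h x => Subtype.ext (mul_smul g h x.1) }
  finite := Subtype.finite

/-- The evaluation map `P → B`. -/
def compEv (p : Bispan X Y) (q : Bispan Y Z) : compP p q →[G] p.B where
  toFun x := x.1.1.σ x.1.2 x.2
  map_smul' g x := by
    change g • x.1.1.σ (g⁻¹ • g • x.1.2) _ = g • x.1.1.σ x.1.2 _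
    simp

/-- The fibre product `A'` of `P` and `A` over `B`. -/
def compA (p : Bispan X Y) (q : Bispan Y Z) : FinGSet.{u} G where
  carrier := {x : compP p q × p.A // p.f x.2 = compEv p q x.1}
  action :=
    { smul := fun g x => ⟨(g • x.1.1, g • x.1.2), by
        change p.f (g • x.1.2) = compEv p q (g • x.1.1)
        rw [map_smul, map_smul, x.2]⟩
      one_smul := fun x => Subtype.ext (one_smul G x.1)
      mul_smul := fun g h x => Subtype.ext (mul_smul g h x.1) }
  finite := Subtype.finite

/-- The projection `P → Q`. -/
def compPB (p : Bispan X Y) (q : Bispan Y Z) : compP p q →[G] compB p q :=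
  ⟨fun x => x.1.1, fun _ _ => rfl⟩

/-- The projection `A' → P`. -/
def compAP (p : Bispan X Y) (q : Bispan Y Z) : compA p q →[G] compP p q :=
  ⟨fun x => x.1.1, fun _ _ => rfl⟩

/-- The projection `Q → D`. -/
def compBD (p : Bispan X Y) (q : Bispan Y Z) : compB p q →[G] q.B :=
  ⟨fun x => x.d, fun _ _ => rfl⟩

/-- The projection `P → C`. -/
def compPC (p : Bispan X Y) (q : Bispan Y Z) : compP p q →[G] q.A :=
  ⟨fun x => x.1.2, fun _ _ => rfl⟩

/-- The projection `A' → A`. -/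
def compAA (p : Bispan X Y) (q : Bispan Y Z) : compA p q →[G] p.A :=
  ⟨fun x => x.1.2, fun _ _ => rfl⟩

/-- The composite of two bispans (first `p`, then `q`). -/
def comp (p : Bispan X Y) (q : Bispan Y Z) : Bispan X Z where
  A := compA p q
  B := compB p q
  s := p.s.comp (compAA p q)
  f := (compPB p q).comp (compAP p q)
  t := q.t.comp (compBD p q)

theorem comp_mem (D : Exponents.{u} G) (p : Bispan X Y) (q : Bispan Y Z) (hp : D.mem p.f)
    (hq : D.mem q.f) : D.mem (p.comp q).f := by
  refine D.comp_mem _ _ (D.pullback_mem (compAP p q) (compAA p q) (compEv p q) p.f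
    ⟨fun a => a.2.symm, fun c b h => ⟨⟨(c, b), h.symm⟩, ⟨rfl, rfl⟩, ?_⟩⟩ hp)
    (D.pullback_mem (compPB p q) (compPC p q) (compBD p q) q.f
    ⟨fun a => a.2.symm, fun c b h => ⟨⟨(c, b), h.symm⟩, ⟨rfl, rfl⟩, ?_⟩⟩ hq)
  · rintro x ⟨rfl, rfl⟩
    rfl
  · rintro x ⟨rfl, rfl⟩
    rfl

/-- The data that exhibits a bispan `r` as a composite of `p` and `q`, in terms of elements. -/
structure IsComp (p : Bispan X Y) (q : Bispan Y Z) (r : Bispan X Z) where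
  δ : r.B →[G] q.B
  E : r.B → q.A → p.B → Prop
  π : r.A →[G] q.A
  ρ : r.A →[G] p.A
  E_smul : ∀ (g : G) b c x, E b c x → E (g • b) (g • c) (g • x)
  E_dom : ∀ b c x, E b c x → q.f c = δ b
  E_t : ∀ b c x, E b c x → p.t x = q.s c
  E_total : ∀ b c, q.f c = δ b → ∃ x, E b c x
  E_unique : ∀ b c x x', E b c x → E b c x' → x = x'
  exists_B : ∀ (d : q.B) (σ : ∀ c : q.A, q.f c = d → p.B), (∀ c h, p.t (σ c h) = q.s c) →
    ∃ b, δ b = d ∧ ∀ c h, E b c (σ c h)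
  ext_B : ∀ b b', δ b = δ b' → (∀ c x, E b c x → E b' c x) → b = b'
  comm_t : ∀ b, r.t b = q.t (δ b)
  comm_s : ∀ a, r.s a = p.s (ρ a)
  E_A : ∀ a, E (r.f a) (π a) (p.f (ρ a))
  exists_A : ∀ b c a, E b c (p.f a) → ∃ a', r.f a' = b ∧ π a' = c ∧ ρ a' = a
  ext_A : ∀ a a', r.f a = r.f a' → π a = π a' → ρ a = ρ a' → a = a'

namespace IsComp

/-- The composite is a composite. -/
def ofComp (p : Bispan X Y) (q : Bispan Y Z) : IsComp p q (p.comp q) where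
  δ := compBD p q
  E b c x := ∃ h : q.f c = b.d, b.σ c h = x
  π := (compPC p q).comp (compAP p q)
  ρ := compAA p q
  E_smul := by
    rintro g b c _ ⟨h, rfl⟩
    refine ⟨by rw [map_smul, h]; rfl, ?_⟩
    change g • b.σ (g⁻¹ • g • c) _ = g • b.σ c _
    simp
  E_dom := by
    rintro b c _ ⟨h, rfl⟩
    exact h
  E_t := by
    rintro b c _ ⟨h, rfl⟩
    exact b.hσ c h
  E_total b c h := ⟨b.σ c h, h, rfl⟩
  E_unique := by
    rintro b c _ _ ⟨h, rfl⟩ ⟨h', rfl⟩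
    rfl
  exists_B d σ hσ := ⟨⟨d, σ, hσ⟩, rfl, fun c h => ⟨h, rfl⟩⟩
  ext_B b b' h h' := CompB.ext' h fun c h1 h2 => by
    obtain ⟨h3, h4⟩ := h' c _ ⟨h1, rfl⟩
    exact h4.symm
  comm_t b := rfl
  comm_s a := rfl
  E_A a := ⟨a.1.1.2, a.2.symm⟩
  exists_A := by
    rintro b c a ⟨h, h'⟩
    exact ⟨⟨(⟨(b, c), h⟩, a), h'.symm⟩, rfl, rfl, rfl⟩
  ext_A := by
    rintro ⟨⟨⟨⟨b, c⟩, h⟩, a⟩, h'⟩ ⟨⟨⟨⟨b', c'⟩, k⟩, a'⟩, k'⟩ h1 h2 h3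
    obtain rfl : b = b' := h1
    obtain rfl : c = c' := h2
    obtain rfl : a = a' := h3
    rfl

theorem exists_map {p : Bispan X Y} {q : Bispan Y Z} {r r' : Bispan X Z} (h : IsComp p q r)
    (h' : IsComp p q r') (b : r.B) :
    ∃ b' : r'.B, h'.δ b' = h.δ b ∧ ∀ c x, h.E b c x ↔ h'.E b' c x := by
  choose σ hσ using h.E_total b
  obtain ⟨b', h1, h2⟩ := h'.exists_B (h.δ b) σ (fun c hc => h.E_t _ _ _ (hσ c hc))
  refine ⟨b', h1, fun c x => ⟨fun hx => ?_, fun hx => ?_⟩⟩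
  · have hc := h.E_dom _ _ _ hx
    rw [h.E_unique _ _ _ _ hx (hσ c hc)]
    exact h2 c hc
  · have hc := (h'.E_dom _ _ _ hx).trans h1
    rw [h'.E_unique _ _ _ _ hx (h2 c hc)]
    exact hσ c hc

theorem eq_of_iff {p : Bispan X Y} {q : Bispan Y Z} {r : Bispan X Z} (h : IsComp p q r)
    {b b' : r.B} (h1 : h.δ b = h.δ b') (h2 : ∀ c x, h.E b c x ↔ h.E b' c x) : b = b' :=
  h.ext_B b b' h1 fun c x => (h2 c x).1

theorem E_smul_iff {p : Bispan X Y} {q : Bispan Y Z} {r : Bispan X Z} (h : IsComp p q r)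
    (g : G) (b : r.B) (c : q.A) (x : p.B) : h.E (g • b) c x ↔ h.E b (g⁻¹ • c) (g⁻¹ • x) := by
  refine ⟨fun hx => ?_, fun hx => ?_⟩
  · simpa using h.E_smul g⁻¹ _ _ _ hx
  · simpa using h.E_smul g _ _ _ hx

/-- Composites are unique up to isomorphism. -/
theorem iso {p : Bispan X Y} {q : Bispan Y Z} {r r' : Bispan X Z} (h : IsComp p q r)
    (h' : IsComp p q r') : Nonempty (Iso r r') := by
  choose β hβ1 hβ2 using exists_map h h'
  choose β' hβ'1 hβ'2 using exists_map h' h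
  have hA : ∀ a, ∃ a' : r'.A, r'.f a' = β (r.f a) ∧ h'.π a' = h.π a ∧ h'.ρ a' = h.ρ a := fun a =>
    h'.exists_A _ _ _ ((hβ2 _ _ _).1 (h.E_A a))
  have hA' : ∀ a, ∃ a' : r.A, r.f a' = β' (r'.f a) ∧ h.π a' = h'.π a ∧ h.ρ a' = h'.ρ a := fun a =>
    h.exists_A _ _ _ ((hβ'2 _ _ _).1 (h'.E_A a))
  choose α hα1 hα2 hα3 using hA
  choose α' hα'1 hα'2 hα'3 using hA'
  have hββ' : ∀ b, β' (β b) = b := fun b => h.eq_of_iff (by rw [hβ'1, hβ1])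
    fun c x => by rw [← hβ'2, ← hβ2]
  have hβ'β : ∀ b, β (β' b) = b := fun b => h'.eq_of_iff (by rw [hβ1, hβ'1])
    fun c x => by rw [← hβ2, ← hβ'2]
  refine ⟨⟨⟨α, α', fun a => ?_, fun a => ?_⟩, ⟨β, β', hββ', hβ'β⟩, fun g a => ?_, fun g b => ?_,
    fun a => ?_, hα1, fun b => ?_⟩⟩
  · exact h.ext_A _ _ (by rw [hα'1, hα1, hββ']) (by rw [hα'2, hα2]) (by rw [hα'3, hα3])
  · exact h'.ext_A _ _ (by rw [hα1, hα'1, hβ'β]) (by rw [hα2, hα'2]) (by rw [hα3, hα'3])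
  · have hβg : β (r.f (g • a)) = g • β (r.f a) :=
      h'.eq_of_iff (by rw [hβ1, map_smul, map_smul, map_smul, hβ1])
        fun c x => by rw [← hβ2, map_smul, h.E_smul_iff, h'.E_smul_iff, ← hβ2]
    exact h'.ext_A _ _ (by simp only [Equiv.coe_fn_mk, map_smul, hα1, ← hβg])
      (by simp only [Equiv.coe_fn_mk, map_smul, hα2])
      (by simp only [Equiv.coe_fn_mk, map_smul, hα3])
  · exact h'.eq_of_iff (by simp only [Equiv.coe_fn_mk, map_smul, hβ1])
      fun c x => by
        simp only [Equiv.coe_fn_mk]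
        rw [← hβ2, h.E_smul_iff, h'.E_smul_iff, ← hβ2]
  · simp only [Equiv.coe_fn_mk]
    rw [h'.comm_s, hα3, h.comm_s]
  · simp only [Equiv.coe_fn_mk]
    rw [h'.comm_t, hβ1, h.comm_t]

/-- Being a composite is invariant under isomorphism of the factors. -/
def ofIso {p p' : Bispan X Y} {q q' : Bispan Y Z} {r : Bispan X Z} (e : Iso p p') (e' : Iso q q')
    (h : IsComp p q r) : IsComp p' q' r where
  δ := ⟨fun b => e'.eB (h.δ b), fun g b => by simp [e'.smul_B]⟩
  E b c x := h.E b (e'.symm.eA c) (e.symm.eB x)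
  π := ⟨fun b => e'.eA (h.π b), fun g b => by simp [e'.smul_A]⟩
  ρ := ⟨fun b => e.eA (h.ρ b), fun g b => by simp [e.smul_A]⟩
  E_smul g b c x hx := by
    rw [e'.symm.smul_A, e.symm.smul_B]
    exact h.E_smul _ _ _ _ hx
  E_dom b c x hx := by
    have := congrArg e'.eB (h.E_dom _ _ _ hx)
    rw [← e'.comm_f] at this
    change q'.f c = e'.eB (h.δ b)
    simpa [Iso.symm] using this
  E_t b c x hx := by
    have := h.E_t _ _ _ hx
    rwa [e.symm.comm_t, e'.symm.comm_s] at this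
  E_total b c hc := by
    replace hc : q'.f c = e'.eB (h.δ b) := hc
    obtain ⟨x, hx⟩ := h.E_total b (e'.symm.eA c) (by
      rw [e'.symm.comm_f, hc]
      simp [Iso.symm])
    exact ⟨e.eB x, by simpa [Iso.symm] using hx⟩
  E_unique b c x x' hx hx' := e.symm.eB.injective (h.E_unique _ _ _ _ hx hx')
  exists_B d σ hσ := by
    obtain ⟨b, h1, h2⟩ := h.exists_B (e'.symm.eB d)
      (fun c hc => e.symm.eB (σ (e'.eA c) (by rw [e'.comm_f, hc]; exact e'.eB.apply_symm_apply d)))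
      (fun c hc => by rw [e.symm.comm_t, hσ, e'.comm_s])
    refine ⟨b, ?_, fun c hc => ?_⟩
    · change e'.eB (h.δ b) = d
      rw [h1]
      exact e'.eB.apply_symm_apply d
    have := h2 (e'.symm.eA c) (by rw [e'.symm.comm_f, hc])
    simpa [Iso.symm] using this
  ext_B b b' hb hE := h.ext_B b b' (e'.eB.injective hb) fun c x hx => by
    have := hE (e'.eA c) (e.eB x) (by simpa [Iso.symm] using hx)
    simpa [Iso.symm] using this
  comm_t b := by
    rw [h.comm_t]
    exact (e'.comm_t _).symm
  comm_s a := by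
    rw [h.comm_s]
    exact (e.comm_s _).symm
  E_A a := by
    have := h.E_A a
    change h.E _ (e'.eA.symm (e'.eA (h.π a))) (e.eB.symm (p'.f (e.eA (h.ρ a))))
    rw [e.comm_f]
    simpa using this
  exists_A b c a hE := by
    rw [← e.symm.comm_f] at hE
    obtain ⟨a', h1, h2, h3⟩ := h.exists_A _ _ _ hE
    refine ⟨a', h1, ?_, ?_⟩
    · change e'.eA (h.π a') = c
      rw [h2]
      simp [Iso.symm]
    · change e.eA (h.ρ a') = a
      rw [h3]
      simp [Iso.symm]
  ext_A a a' h1 h2 h3 := h.ext_A a a' h1 (e'.eA.injective h2) (e.eA.injective h3)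

/-- Left unit. -/
def idLeft (p : Bispan X Y) : IsComp (Bispan.id X) p p where
  δ := MulActionHom.id G
  E b c x := p.f c = b ∧ x = p.s c
  π := MulActionHom.id G
  ρ := p.s
  E_smul := by
    rintro g _ c _ ⟨rfl, rfl⟩
    exact ⟨map_smul _ _ _, (map_smul _ _ _).symm⟩
  E_dom := by
    rintro _ c _ ⟨rfl, rfl⟩
    rfl
  E_t := by
    rintro _ c _ ⟨rfl, rfl⟩
    rfl
  E_total b c h := ⟨_, h, rfl⟩
  E_unique := by
    rintro b c _ _ ⟨_, rfl⟩ ⟨_, rfl⟩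
    rfl
  exists_B d σ hσ := ⟨d, rfl, fun c h => ⟨h, hσ c h⟩⟩
  ext_B b b' h _ := h
  comm_t b := rfl
  comm_s a := rfl
  E_A a := ⟨rfl, rfl⟩
  exists_A b c a h := ⟨c, h.1, rfl, h.2.symm⟩
  ext_A a a' _ h _ := h

/-- Right unit. -/
def idRight (p : Bispan X Y) : IsComp p (Bispan.id Y) p where
  δ := p.t
  E b c x := c = p.t b ∧ x = b
  π := p.t.comp p.f
  ρ := MulActionHom.id G
  E_smul := by
    rintro g b _ _ ⟨rfl, rfl⟩
    exact ⟨(map_smul _ _ _).symm, rfl⟩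
  E_dom := by
    rintro b _ _ ⟨rfl, rfl⟩
    rfl
  E_t := by
    rintro b _ _ ⟨rfl, rfl⟩
    rfl
  E_total b c h := ⟨b, h, rfl⟩
  E_unique := by
    rintro b c _ _ ⟨_, rfl⟩ ⟨_, rfl⟩
    rfl
  exists_B d σ hσ := by
    refine ⟨σ d rfl, hσ d rfl, fun c h => ?_⟩
    obtain rfl : c = d := h
    exact ⟨(hσ c rfl).symm, rfl⟩
  ext_B b b' h h' := (h' _ _ ⟨rfl, rfl⟩).2
  comm_t b := rfl
  comm_s a := rfl
  E_A a := ⟨rfl, rfl⟩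
  exists_A := by
    rintro b _ a ⟨rfl, h⟩
    exact ⟨a, h, congrArg p.t h, rfl⟩
  ext_A a a' _ _ h := h

/-- Associativity: if `r₁` is a composite of `p`, `q`, and `s` of `r₁`, `w`, and `r₂` of `q`, `w`,
then `s` is a composite of `p`, `r₂`. -/
theorem assoc {p : Bispan W X} {q : Bispan X Y} {w : Bispan Y Z} {r₁ : Bispan W Y}
    {r₂ : Bispan X Z} {s : Bispan W Z} (h₁ : IsComp p q r₁) (h₂ : IsComp r₁ w s)
    (h₃ : IsComp q w r₂) : Nonempty (IsComp p r₂ s) := by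
  have hβ : ∀ b : s.B, ∃ b' : r₂.B, h₃.δ b' = h₂.δ b ∧
      ∀ c y, h₂.E b c y → h₃.E b' c (h₁.δ y) := by
    intro b
    choose σ hσ using h₂.E_total b
    obtain ⟨b', h1, h2⟩ := h₃.exists_B (h₂.δ b) (fun c hc => h₁.δ (σ c hc)) (fun c hc => by
      rw [← h₁.comm_t]
      exact h₂.E_t _ _ _ (hσ c hc))
    refine ⟨b', h1, fun c y hy => ?_⟩
    have hc := h₂.E_dom _ _ _ hy
    rw [h₂.E_unique _ _ _ _ hy (hσ c hc)]
    exact h2 c hc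
  choose β hβ1 hβ2 using hβ
  have hβu : ∀ (b : s.B) (b' : r₂.B), h₃.δ b' = h₂.δ b →
      (∀ c y, h₂.E b c y → h₃.E b' c (h₁.δ y)) → β b = b' := by
    intro b b' h1 h2
    refine h₃.ext_B _ _ (by rw [hβ1, h1]) fun c x hx => ?_
    obtain ⟨y, hy⟩ := h₂.E_total b c (by rw [h₃.E_dom _ _ _ hx, hβ1])
    rw [h₃.E_unique _ _ _ _ hx (hβ2 _ _ _ hy)]
    exact h2 _ _ hy
  have hβs : ∀ (g : G) (b : s.B), β (g • b) = g • β b := by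
    intro g b
    refine hβu _ _ (by rw [map_smul, map_smul, hβ1]) fun c y hy => ?_
    rw [h₃.E_smul_iff, ← map_smul]
    exact hβ2 _ _ _ ((h₂.E_smul_iff _ _ _ _).1 hy)
  have hα : ∀ a : s.A, ∃ a' : r₂.A, r₂.f a' = β (s.f a) ∧ h₃.π a' = h₂.π a ∧
      h₃.ρ a' = h₁.π (h₂.ρ a) := by
    intro a
    refine h₃.exists_A _ _ _ ?_
    rw [h₁.E_dom _ _ _ (h₁.E_A (h₂.ρ a))]
    exact hβ2 _ _ _ (h₂.E_A a)
  choose α hα1 hα2 hα3 using hα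
  have hαs : ∀ (g : G) (a : s.A), α (g • a) = g • α a := by
    intro g a
    refine h₃.ext_A _ _ ?_ ?_ ?_
    · rw [hα1, map_smul, hβs, map_smul, hα1]
    · rw [hα2, map_smul, map_smul, hα2]
    · rw [hα3, map_smul, map_smul, map_smul, hα3]
  refine ⟨{
    δ := ⟨β, hβs⟩
    E := fun b c x => r₂.f c = β b ∧ ∃ y, h₂.E b (h₃.π c) y ∧ h₁.E y (h₃.ρ c) x
    π := ⟨α, hαs⟩
    ρ := h₁.ρ.comp h₂.ρ
    E_smul := ?_
    E_dom := fun b c x h => h.1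
    E_t := ?_
    E_total := ?_
    E_unique := ?_
    exists_B := ?_
    ext_B := ?_
    comm_t := ?_
    comm_s := ?_
    E_A := ?_
    exists_A := ?_
    ext_A := ?_ }⟩
  · rintro g b c x ⟨h1, y, h2, h3⟩
    refine ⟨by rw [map_smul, h1, hβs], g • y, ?_, ?_⟩
    · rw [map_smul]
      exact h₂.E_smul _ _ _ _ h2
    · rw [map_smul]
      exact h₁.E_smul _ _ _ _ h3
  · rintro b c x ⟨h1, y, h2, h3⟩
    rw [h₁.E_t _ _ _ h3, h₃.comm_s]
  · intro b c (h : r₂.f c = β b)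
    have h4 := h₃.E_A c
    obtain ⟨y, hy⟩ := h₂.E_total b (h₃.π c) (by rw [h₃.E_dom _ _ _ h4, h, hβ1])
    rw [h] at h4
    obtain ⟨x, hx⟩ := h₁.E_total y (h₃.ρ c) (h₃.E_unique _ _ _ _ h4 (hβ2 _ _ _ hy))
    exact ⟨x, h, y, hy, hx⟩
  · rintro b c x x' ⟨h1, y, h2, h3⟩ ⟨h1', y', h2', h3'⟩
    obtain rfl := h₂.E_unique _ _ _ _ h2 h2'
    exact h₁.E_unique _ _ _ _ h3 h3'
  · intro d σ hσ
    -- for every point `c` of the fibre of `w`, assemble the point of `r₁.B`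
    have hy : ∀ c : w.A, w.f c = h₃.δ d → ∃ y : r₁.B, r₁.t y = w.s c ∧ h₃.E d c (h₁.δ y) ∧
        ∀ (a : r₂.A) (ha : r₂.f a = d), h₃.π a = c → h₁.E y (h₃.ρ a) (σ a ha) := by
      intro c hc
      obtain ⟨x, hx⟩ := h₃.E_total d c hc
      have hex : ∀ e : q.A, q.f e = x → ∃ a : r₂.A, r₂.f a = d ∧ h₃.π a = c ∧ h₃.ρ a = e := by
        rintro e rfl
        exact h₃.exists_A _ _ _ hx
      choose a ha1 ha2 ha3 using hex
      obtain ⟨y, hy1, hy2⟩ := h₁.exists_B x (fun e he => σ (a e he) (ha1 e he)) (fun e he => by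
        rw [hσ, h₃.comm_s, ha3])
      refine ⟨y, by rw [h₁.comm_t, hy1, h₃.E_t _ _ _ hx], by rw [hy1]; exact hx, ?_⟩
      intro a' ha' hc'
      have hf : q.f (h₃.ρ a') = x := by
        have h5 := h₃.E_A a'
        rw [ha', hc'] at h5
        exact h₃.E_unique _ _ _ _ h5 hx
      have haa : a (h₃.ρ a') hf = a' := h₃.ext_A _ _ (by rw [ha1, ha']) (by rw [ha2, hc'])
        (by rw [ha3])
      have := hy2 (h₃.ρ a') hf
      simpa only [haa] using this
    choose τ hτ1 hτ2 hτ3 using hy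
    obtain ⟨b, hb1, hb2⟩ := h₂.exists_B (h₃.δ d) τ hτ1
    have hbd : β b = d := hβu _ _ hb1.symm fun c y hy => by
      have hc := (h₂.E_dom _ _ _ hy).trans hb1
      rw [h₂.E_unique _ _ _ _ hy (hb2 c hc)]
      exact hτ2 c hc
    refine ⟨b, hbd, fun c h => ⟨h.trans hbd.symm, ?_⟩⟩
    have hc : w.f (h₃.π c) = h₃.δ d := by rw [h₃.E_dom _ _ _ (h₃.E_A c), h]
    exact ⟨τ _ hc, hb2 _ hc, hτ3 _ hc c h rfl⟩
  · intro b b' (h : β b = β b') hE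
    have hδ : h₂.δ b = h₂.δ b' := by rw [← hβ1, h, hβ1]
    refine h₂.ext_B _ _ hδ fun c y hy => ?_
    obtain ⟨y', hy'⟩ := h₂.E_total b' c (by rw [h₂.E_dom _ _ _ hy, hδ])
    have h3 := hβ2 _ _ _ hy
    have h3' := hβ2 _ _ _ hy'
    rw [← h] at h3'
    have hyy : h₁.δ y = h₁.δ y' := h₃.E_unique _ _ _ _ h3 h3'
    suffices y = y' by rwa [this]
    refine h₁.ext_B _ _ hyy fun e x hx => ?_
    have h4 := h₁.E_dom _ _ _ hx
    rw [← h4] at h3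
    obtain ⟨a, ha1, ha2, ha3⟩ := h₃.exists_A _ _ _ h3
    obtain ⟨_, y'', h5, h6⟩ := hE a x ⟨ha1, y, by rwa [ha2], by rwa [ha3]⟩
    rw [ha2] at h5
    rw [ha3] at h6
    rwa [h₂.E_unique _ _ _ _ hy' h5]
  · intro b
    change s.t b = r₂.t (β b)
    rw [h₂.comm_t, h₃.comm_t, hβ1]
  · intro a
    rw [h₂.comm_s, h₁.comm_s]
    rfl
  · intro a
    refine ⟨hα1 a, h₂.ρ a |> r₁.f, ?_, ?_⟩
    · change h₂.E _ (h₃.π (α a)) _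
      rw [hα2]
      exact h₂.E_A a
    · change h₁.E _ (h₃.ρ (α a)) _
      rw [hα3]
      exact h₁.E_A _
  · rintro b c a ⟨h1, y, h2, h3⟩
    obtain ⟨a₁, h4, h5, h6⟩ := h₁.exists_A _ _ _ h3
    rw [← h4] at h2
    obtain ⟨a₂, h7, h8, h9⟩ := h₂.exists_A _ _ _ h2
    refine ⟨a₂, h7, ?_, ?_⟩
    · exact h₃.ext_A _ _ ((hα1 _).trans (by rw [h7, h1])) ((hα2 _).trans h8)
        ((hα3 _).trans (by rw [h9, h5]))
    · change h₁.ρ (h₂.ρ a₂) = a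
      rw [h9, h6]
  · intro a a' h1 (h2 : α a = α a') (h3 : h₁.ρ (h₂.ρ a) = h₁.ρ (h₂.ρ a'))
    have h4 : h₂.π a = h₂.π a' := by rw [← hα2, h2, hα2]
    refine h₂.ext_A _ _ h1 h4 (h₁.ext_A _ _ ?_ ?_ h3)
    · refine h₂.E_unique _ _ _ _ (h₂.E_A a) ?_
      rw [h1, h4]
      exact h₂.E_A a'
    · rw [← hα3, h2, hα3]

end IsComp

end Bispan

section PolyCategory

variable {G : Type u} [Group G]

/-- Isomorphism of bispans `X ← A → B → Y` with `A → B` in `D`. -/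
def polySetoid (D : Exponents.{u} G) (X Y : FinGSet.{u} G) :
    Setoid {p : Bispan X Y // D.mem p.f} where
  r p q := Nonempty (Bispan.Iso p.1 q.1)
  iseqv :=
    { refl := fun _ => ⟨Bispan.Iso.refl _⟩
      symm := fun ⟨e⟩ => ⟨e.symm⟩
      trans := fun ⟨e⟩ ⟨e'⟩ => ⟨e.trans e'⟩ }

/-- The category `P^G_D` of polynomials in finite `G`-sets with exponents in `D`. Its objects are
the finite `G`-sets. -/
structure Poly (D : Exponents.{u} G) : Type (u + 1) where
  of ::
  set : FinGSet.{u} G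

/-- The morphisms of `P^G_D`: isomorphism classes of bispans `X ← A → B → Y` with `A → B`
in `D`. -/
def PolyHom (D : Exponents.{u} G) (X Y : FinGSet.{u} G) : Type (u + 1) :=
  Quotient (polySetoid D X Y)

/-- The class of a bispan. -/
def PolyHom.mk {D : Exponents.{u} G} {X Y : FinGSet.{u} G} (p : Bispan X Y) (hp : D.mem p.f) :
    PolyHom D X Y :=
  Quotient.mk (polySetoid D X Y) ⟨p, hp⟩

theorem PolyHom.exists_rep {D : Exponents.{u} G} {X Y : FinGSet.{u} G} (f : PolyHom D X Y) :
    ∃ p hp, f = PolyHom.mk p hp := by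
  obtain ⟨p⟩ := f
  exact ⟨p.1, p.2, rfl⟩

theorem PolyHom.mk_eq {D : Exponents.{u} G} {X Y : FinGSet.{u} G} {p q : Bispan X Y}
    {hp : D.mem p.f} {hq : D.mem q.f} :
    PolyHom.mk p hp = PolyHom.mk q hq ↔ Nonempty (Bispan.Iso p q) :=
  Quotient.eq (r := polySetoid D X Y)

/-- Composition of classes of bispans. -/
def PolyHom.comp {D : Exponents.{u} G} {X Y Z : FinGSet.{u} G} (f : PolyHom D X Y)
    (g : PolyHom D Y Z) : PolyHom D X Z :=
  Quotient.map₂ (fun p q => ⟨p.1.comp q.1, Bispan.comp_mem D p.1 q.1 p.2 q.2⟩)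
    (by
      rintro p p' ⟨e⟩ q q' ⟨e'⟩
      exact ((Bispan.IsComp.ofComp _ _).ofIso e e').iso (Bispan.IsComp.ofComp _ _)) f g

theorem PolyHom.comp_eq {D : Exponents.{u} G} {X Y Z : FinGSet.{u} G} {p : Bispan X Y}
    {q : Bispan Y Z} {r : Bispan X Z} {hp : D.mem p.f} {hq : D.mem q.f} {hr : D.mem r.f}
    (h : Bispan.IsComp p q r) :
    (PolyHom.mk p hp).comp (PolyHom.mk q hq) = PolyHom.mk r hr :=
  PolyHom.mk_eq.2 ((Bispan.IsComp.ofComp p q).iso h)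

instance (D : Exponents.{u} G) : Category.{u + 1} (Poly D) where
  Hom X Y := PolyHom D X.set Y.set
  id X := PolyHom.mk (Bispan.id X.set) (D.id_mem X.set)
  comp f g := PolyHom.comp f g
  id_comp f := by
    obtain ⟨p, hp, rfl⟩ := PolyHom.exists_rep f
    exact PolyHom.comp_eq (Bispan.IsComp.idLeft p)
  comp_id f := by
    obtain ⟨p, hp, rfl⟩ := PolyHom.exists_rep f
    exact PolyHom.comp_eq (Bispan.IsComp.idRight p)
  assoc f g h := by
    obtain ⟨p, hp, rfl⟩ := PolyHom.exists_rep f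
    obtain ⟨q, hq, rfl⟩ := PolyHom.exists_rep g
    obtain ⟨w, hw, rfl⟩ := PolyHom.exists_rep h
    obtain ⟨k⟩ := (Bispan.IsComp.ofComp p q).assoc (Bispan.IsComp.ofComp (p.comp q) w)
      (Bispan.IsComp.ofComp q w)
    exact (PolyHom.comp_eq k (hr := Bispan.comp_mem D _ _ (Bispan.comp_mem D _ _ hp hq) hw)).symm

end PolyCategory

namespace Poly

variable {G : Type u} [Group G] {D : Exponents.{u} G} {X Y Z W : FinGSet.{u} G}

/-- The restriction `R_j : Y ⟶ X` of a map `j : X → Y`. -/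
def R (D : Exponents.{u} G) (j : X →[G] Y) : (Poly.of Y : Poly D) ⟶ Poly.of X :=
  PolyHom.mk (Bispan.R j) (D.id_mem X)

/-- The transfer `T_h : X ⟶ Y` of a map `h : X → Y`. -/
def T (D : Exponents.{u} G) (h : X →[G] Y) : (Poly.of X : Poly D) ⟶ Poly.of Y :=
  PolyHom.mk (Bispan.T h) (D.id_mem X)

end Poly

/-! #### Finite products of polynomials

Disjoint unions are products in the category of polynomials. -/

namespace Bispan

variable {G : Type u} [Group G] {W X Y Z : FinGSet.{u} G}

/-- The data that exhibits `p` as the part of the bispan `m` over `i : X → Z`. -/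
structure Restr (i : X →[G] Z) (m : Bispan W Z) (p : Bispan W X) where
  α : p.A →[G] m.A
  β : p.B →[G] m.B
  comm_t : ∀ b, m.t (β b) = i (p.t b)
  comm_f : ∀ a, m.f (α a) = β (p.f a)
  comm_s : ∀ a, m.s (α a) = p.s a
  exists_B : ∀ b x, m.t b = i x → ∃ b', β b' = b ∧ p.t b' = x
  ext_B : ∀ b b', β b = β b' → p.t b = p.t b' → b = b'
  exists_A : ∀ a b, m.f a = β b → ∃ a', α a' = a ∧ p.f a' = b
  ext_A : ∀ a a', α a = α a' → p.f a = p.f a' → a = a'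

/-- The part of `m` over `i` is the composite of `m` and `R_i`. -/
def Restr.isComp {i : X →[G] Z} {m : Bispan W Z} {p : Bispan W X} (h : Restr i m p) :
    IsComp m (R i) p where
  δ := p.t
  E b c x := c = p.t b ∧ x = h.β b
  π := p.t.comp p.f
  ρ := h.α
  E_smul := by
    rintro g b _ _ ⟨rfl, rfl⟩
    exact ⟨(map_smul _ _ _).symm, (map_smul _ _ _).symm⟩
  E_dom := by
    rintro b _ _ ⟨rfl, rfl⟩
    rfl
  E_t := by
    rintro b _ _ ⟨rfl, rfl⟩
    exact h.comm_t b
  E_total b c hc := ⟨_, hc, rfl⟩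
  E_unique := by
    rintro b c _ _ ⟨_, rfl⟩ ⟨_, rfl⟩
    rfl
  exists_B d σ hσ := by
    obtain ⟨b, h1, h2⟩ := h.exists_B (σ d rfl) d (hσ d rfl)
    refine ⟨b, h2, fun c hc => ?_⟩
    obtain rfl : c = d := hc
    exact ⟨h2.symm, h1.symm⟩
  ext_B b b' h1 h2 := h.ext_B _ _ (h2 _ _ ⟨rfl, rfl⟩).2 h1
  comm_t b := rfl
  comm_s a := (h.comm_s a).symm
  E_A a := ⟨rfl, h.comm_f a⟩
  exists_A := by
    rintro b _ a ⟨rfl, h1⟩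
    obtain ⟨a', h2, h3⟩ := h.exists_A _ _ h1
    exact ⟨a', h3, congrArg p.t h3, h2⟩
  ext_A a a' h1 _ h2 := h.ext_A _ _ h2 h1

theorem IsComp.restr {i : X →[G] Z} {m : Bispan W Z} {p : Bispan W X}
    (h : IsComp m (R i) p) : Nonempty (Restr i m p) := by
  have hβ := fun b => h.E_total b (h.δ b) rfl
  choose β hβ using hβ
  have hδ : ∀ b, h.δ b = p.t b := fun b => (h.comm_t b).symm
  have hπ : ∀ a, h.π a = h.δ (p.f a) := fun a => h.E_dom _ _ _ (h.E_A a)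
  have hα : ∀ a, m.f (h.ρ a) = β (p.f a) := fun a => by
    have h1 := h.E_A a
    rw [hπ] at h1
    exact h.E_unique _ _ _ _ h1 (hβ _)
  have hβs : ∀ (g : G) b, β (g • b) = g • β b := fun g b => by
    refine h.E_unique _ _ _ _ (hβ _) ?_
    rw [map_smul]
    exact h.E_smul _ _ _ _ (hβ b)
  refine ⟨⟨h.ρ, ⟨β, hβs⟩, fun b => ?_, hα, fun a => (h.comm_s a).symm, fun b x hx => ?_,
    fun b b' h1 h2 => ?_, fun a b hab => ?_, fun a a' h1 h2 => ?_⟩⟩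
  · rw [← hδ]
    exact h.E_t _ _ _ (hβ b)
  · obtain ⟨b', h1, h2⟩ := h.exists_B x (fun c _ => b) (fun c hc => by
      obtain rfl : c = x := hc
      exact hx)
    refine ⟨b', ?_, by rw [← hδ, h1]⟩
    have h3 := hβ b'
    rw [h1] at h3
    exact h.E_unique _ _ _ _ h3 (h2 x rfl)
  · have hd : h.δ b = h.δ b' := by rw [hδ, h2, hδ]
    refine h.ext_B _ _ hd fun c x hx => ?_
    obtain rfl : c = h.δ b := h.E_dom _ _ _ hx
    rw [h.E_unique _ _ _ _ hx (hβ b), hd, show β b = β b' from h1]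
    exact hβ b'
  · have h1 : h.E b (h.δ b) (m.f a) := by
      rw [hab]
      exact hβ b
    obtain ⟨a', h2, _, h4⟩ := h.exists_A _ _ _ h1
    exact ⟨a', h4, h2⟩
  · exact h.ext_A _ _ h2 (by rw [hπ, hπ, h2]) h1

/-- Being the part of `m` over `i` is invariant under isomorphism. -/
def Restr.ofIso {i : X →[G] Z} {m : Bispan W Z} {p p' : Bispan W X} (h : Restr i m p)
    (e : Iso p' p) : Restr i m p' where
  α := ⟨fun a => h.α (e.eA a), fun g a => by simp [e.smul_A]⟩
  β := ⟨fun b => h.β (e.eB b), fun g a => by simp [e.smul_B]⟩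
  comm_t b := by
    rw [← e.comm_t]
    exact h.comm_t _
  comm_f a := by
    refine (h.comm_f _).trans ?_
    rw [e.comm_f]
    rfl
  comm_s a := by
    rw [← e.comm_s]
    exact h.comm_s _
  exists_B b x hx := by
    obtain ⟨b', h1, h2⟩ := h.exists_B b x hx
    refine ⟨e.eB.symm b', ?_, ?_⟩
    · change h.β (e.eB _) = b
      rw [Equiv.apply_symm_apply, h1]
    · rw [← e.comm_t, Equiv.apply_symm_apply, h2]
  ext_B b b' h1 h2 := e.eB.injective (h.ext_B _ _ h1 (by rw [e.comm_t, e.comm_t, h2]))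
  exists_A a b hab := by
    obtain ⟨a', h1, h2⟩ := h.exists_A a (e.eB b) hab
    refine ⟨e.eA.symm a', ?_, ?_⟩
    · change h.α (e.eA _) = a
      rw [Equiv.apply_symm_apply, h1]
    · refine e.eB.injective ?_
      rw [← e.comm_f, Equiv.apply_symm_apply, h2]
  ext_A a a' h1 h2 := e.eA.injective (h.ext_A _ _ h1 (by rw [e.comm_f, e.comm_f, h2]))

/-- The bispan with given parts over `i : X → Z` and `j : Y → Z`. -/
def glue (i : X →[G] Z) (j : Y →[G] Z) (p : Bispan W X) (q : Bispan W Y) : Bispan W Z where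
  A := p.A.sum q.A
  B := p.B.sum q.B
  s := desc p.s q.s
  f := sumMap p.f q.f
  t := desc (i.comp p.t) (j.comp q.t)

section

variable {i : X →[G] Z} {j : Y →[G] Z}

theorem inl_inj (hij : IsCoprod i j) {x x' : X} (h : i x = i x') : x = x' :=
  Sum.inl_injective (hij.1 (a₁ := Sum.inl x) (a₂ := Sum.inl x') h)

theorem inr_inj (hij : IsCoprod i j) {y y' : Y} (h : j y = j y') : y = y' :=
  Sum.inr_injective (hij.1 (a₁ := Sum.inr y) (a₂ := Sum.inr y') h)

theorem inl_ne_inr (hij : IsCoprod i j) {x : X} {y : Y} (h : i x = j y) : False :=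
  Sum.inl_ne_inr (hij.1 (a₁ := Sum.inl x) (a₂ := Sum.inr y) h)

/-- The first part. -/
def glueInl (hij : IsCoprod i j) (p : Bispan W X) (q : Bispan W Y) : Restr i (glue i j p q) p where
  α := inl _ _
  β := inl _ _
  comm_t _ := rfl
  comm_f _ := rfl
  comm_s _ := rfl
  exists_B := by
    rintro (b | b) x h
    · exact ⟨b, rfl, inl_inj hij h⟩
    · exact (inl_ne_inr hij h.symm).elim
  ext_B b b' h _ := Sum.inl_injective h
  exists_A := by
    rintro (a | a) b h
    · exact ⟨a, rfl, Sum.inl_injective h⟩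
    · exact (Sum.inr_ne_inl h).elim
  ext_A a a' h _ := Sum.inl_injective h

/-- The second part. -/
def glueInr (hij : IsCoprod i j) (p : Bispan W X) (q : Bispan W Y) : Restr j (glue i j p q) q where
  α := inr _ _
  β := inr _ _
  comm_t _ := rfl
  comm_f _ := rfl
  comm_s _ := rfl
  exists_B := by
    rintro (b | b) x h
    · exact (inl_ne_inr hij h).elim
    · exact ⟨b, rfl, inr_inj hij h⟩
  ext_B b b' h _ := Sum.inr_injective h
  exists_A := by
    rintro (a | a) b h
    · exact (Sum.inl_ne_inr h).elim
    · exact ⟨a, rfl, Sum.inr_injective h⟩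
  ext_A a a' h _ := Sum.inr_injective h

theorem glueIso (hij : IsCoprod i j) {m : Bispan W Z} {p : Bispan W X} {q : Bispan W Y} (h : Restr i m p)
    (k : Restr j m q) : Nonempty (Iso (glue i j p q) m) := by
  have hiB : ∀ b b', h.β b = h.β b' → b = b' := fun b b' hb => h.ext_B _ _ hb
    (inl_inj hij (by rw [← h.comm_t, hb, h.comm_t]))
  have hjB : ∀ b b', k.β b = k.β b' → b = b' := fun b b' hb => k.ext_B _ _ hb
    (inr_inj hij (by rw [← k.comm_t, hb, k.comm_t]))
  have hne : ∀ b b', h.β b = k.β b' → False := fun b b' hb =>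
    inl_ne_inr hij (by rw [← h.comm_t, hb, k.comm_t])
  have hB : Function.Bijective (desc h.β k.β) := by
    constructor
    · rintro (b | b) (b' | b') hb
      · exact congrArg Sum.inl (hiB _ _ hb)
      · exact (hne _ _ hb).elim
      · exact (hne _ _ hb.symm).elim
      · exact congrArg Sum.inr (hjB _ _ hb)
    · intro b
      obtain ⟨x | y, hx⟩ := hij.2 (m.t b)
      · obtain ⟨b', hb', _⟩ := h.exists_B b x hx.symm
        exact ⟨Sum.inl b', hb'⟩
      · obtain ⟨b', hb', _⟩ := k.exists_B b y hx.symm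
        exact ⟨Sum.inr b', hb'⟩
  have hA : Function.Bijective (desc h.α k.α) := by
    constructor
    · rintro (b | b) (b' | b') hb
      · exact congrArg Sum.inl (h.ext_A _ _ hb (hiB _ _ (by
          rw [← h.comm_f, ← h.comm_f]
          exact congrArg m.f hb)))
      · exact (hne (p.f b) (q.f b') (by
          rw [← h.comm_f, ← k.comm_f]
          exact congrArg m.f hb)).elim
      · exact (hne (p.f b') (q.f b) (by
          rw [← h.comm_f, ← k.comm_f]
          exact congrArg m.f hb.symm)).elim
      · exact congrArg Sum.inr (k.ext_A _ _ hb (hjB _ _ (by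
          rw [← k.comm_f, ← k.comm_f]
          exact congrArg m.f hb)))
    · intro a
      obtain ⟨b | b, hb⟩ := hB.2 (m.f a)
      · obtain ⟨a', ha', _⟩ := h.exists_A a b hb.symm
        exact ⟨Sum.inl a', ha'⟩
      · obtain ⟨a', ha', _⟩ := k.exists_A a b hb.symm
        exact ⟨Sum.inr a', ha'⟩
  refine ⟨⟨Equiv.ofBijective _ hA, Equiv.ofBijective _ hB, fun g a => map_smul (desc h.α k.α) g a,
    fun g b => map_smul (desc h.β k.β) g b, ?_, ?_, ?_⟩⟩
  · rintro (a | a)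
    · exact h.comm_s a
    · exact k.comm_s a
  · rintro (a | a)
    · exact h.comm_f a
    · exact k.comm_f a
  · rintro (b | b)
    · exact h.comm_t b
    · exact k.comm_t b

end

/-- The composite of `m` and `T_h`. -/
def compT (m : Bispan W X) (h : X →[G] Y) : Bispan W Y := ⟨m.A, m.B, m.s, m.f, h.comp m.t⟩

/-- The composite of `m` and `T_h`. -/
def isCompT (m : Bispan W X) (h : X →[G] Y) : IsComp m (T h) (compT m h) where
  δ := m.t
  E b c x := c = m.t b ∧ x = b
  π := m.t.comp m.f
  ρ := MulActionHom.id G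
  E_smul := by
    rintro g b _ _ ⟨rfl, rfl⟩
    exact ⟨(map_smul _ _ _).symm, rfl⟩
  E_dom := by
    rintro b _ _ ⟨rfl, rfl⟩
    rfl
  E_t := by
    rintro b _ _ ⟨rfl, rfl⟩
    rfl
  E_total b c h := ⟨b, h, rfl⟩
  E_unique := by
    rintro b c _ _ ⟨_, rfl⟩ ⟨_, rfl⟩
    rfl
  exists_B d σ hσ := by
    refine ⟨σ d rfl, hσ d rfl, fun c h => ?_⟩
    obtain rfl : c = d := h
    exact ⟨(hσ c rfl).symm, rfl⟩
  ext_B b b' h h' := (h' _ _ ⟨rfl, rfl⟩).2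
  comm_t b := rfl
  comm_s a := rfl
  E_A a := ⟨rfl, rfl⟩
  exists_A := by
    rintro b _ a ⟨rfl, h⟩
    exact ⟨a, h, congrArg m.t h, rfl⟩
  ext_A a a' _ _ h := h

end Bispan

namespace Poly

variable {G : Type u} [Group G] {D : Exponents.{u} G} {X Y Z : FinGSet.{u} G}

theorem comp_R {W : Poly D} {i : X →[G] Z} {m : Bispan W.set Z} {p : Bispan W.set X}
    {hm : D.mem m.f} {hp : D.mem p.f} :
    (PolyHom.mk m hm).comp (R D i) = PolyHom.mk p hp ↔ Nonempty (Bispan.Restr i m p) := by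
  constructor
  · intro h
    obtain ⟨e⟩ := PolyHom.mk_eq.1 h
    obtain ⟨k⟩ := (Bispan.IsComp.ofComp m (Bispan.R i)).restr
    exact ⟨k.ofIso e.symm⟩
  · rintro ⟨h⟩
    exact PolyHom.comp_eq h.isComp

theorem T_comp_T (f : X →[G] Y) (g : Y →[G] Z) : T D f ≫ T D g = T D (g.comp f) :=
  PolyHom.comp_eq (Bispan.isCompT (Bispan.T f) g)

theorem existsUnique_lift {i : X →[G] Z} {j : Y →[G] Z} (hij : IsCoprod i j) {W : Poly D}
    (f : W ⟶ Poly.of X) (g : W ⟶ Poly.of Y) :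
    ∃ l : W ⟶ Poly.of Z, (l ≫ R D i = f ∧ l ≫ R D j = g) ∧
      ∀ m : W ⟶ Poly.of Z, m ≫ R D i = f → m ≫ R D j = g → m = l := by
  obtain ⟨p, hp, rfl⟩ := PolyHom.exists_rep f
  obtain ⟨q, hq, rfl⟩ := PolyHom.exists_rep g
  refine ⟨PolyHom.mk (Bispan.glue i j p q) (D.sum_mem _ _ hp hq),
    ⟨comp_R.2 ⟨Bispan.glueInl hij p q⟩, comp_R.2 ⟨Bispan.glueInr hij p q⟩⟩, fun m h k => ?_⟩
  obtain ⟨m, hm, rfl⟩ := PolyHom.exists_rep m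
  obtain ⟨h'⟩ := comp_R.1 h
  obtain ⟨k'⟩ := comp_R.1 k
  exact (PolyHom.mk_eq.2 (Bispan.glueIso hij h' k')).symm

/-- A disjoint union is a product in the category of polynomials. -/
noncomputable def isLimitFan {i : X →[G] Z} {j : Y →[G] Z} (hij : IsCoprod i j) :
    IsLimit (BinaryFan.mk (R D i) (R D j)) :=
  BinaryFan.isLimitMk (fun s => (existsUnique_lift hij s.fst s.snd).choose)
    (fun s => (existsUnique_lift hij s.fst s.snd).choose_spec.1.1)
    (fun s => (existsUnique_lift hij s.fst s.snd).choose_spec.1.2)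
    (fun s => (existsUnique_lift hij s.fst s.snd).choose_spec.2)

/-- An empty set is terminal in the category of polynomials. -/
def isTerminal (D : Exponents.{u} G) (X : FinGSet.{u} G) [IsEmpty X] :
    IsTerminal (Poly.of X : Poly D) :=
  IsTerminal.ofUniqueHom
    (fun W => PolyHom.mk ⟨X, X, ⟨fun x => isEmptyElim x, fun _ x => isEmptyElim x⟩,
      MulActionHom.id G, MulActionHom.id G⟩ (D.id_mem X))
    (fun W m => by
      obtain ⟨m, hm, rfl⟩ := PolyHom.exists_rep m
      have hB : IsEmpty m.B := ⟨fun b => isEmptyElim (m.t b : X)⟩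
      have hA : IsEmpty m.A := ⟨fun a => isEmptyElim (m.f a)⟩
      exact PolyHom.mk_eq.2 ⟨⟨Equiv.equivOfIsEmpty _ _, Equiv.equivOfIsEmpty _ _,
        fun _ a => isEmptyElim a, fun _ a => isEmptyElim a, fun a => isEmptyElim a,
        fun a => isEmptyElim a, fun a => isEmptyElim a⟩⟩)

end Poly

theorem FinGSet.isCoprod_sum {G : Type u} [Group G] (X Y : FinGSet.{u} G) :
    IsCoprod (inl X Y) (inr X Y) := by
  constructor
  · rintro (x | x) (y | y) h <;> exact h
  · rintro (x | x)
    · exact ⟨Sum.inl x, rfl⟩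
    · exact ⟨Sum.inr x, rfl⟩

/-! ### Incomplete Tambara functors -/

section Tambara

variable {G : Type u} [Group G] {D : Exponents.{u} G}

/-- `z` is the sum of `x` and `y` in `R(X)`: addition is the transfer along the fold map,
`R(X) × R(X) ≅ R(X ⊔ X) → R(X)`. -/
def IsSum (R : Poly D ⥤ Type w) {X : FinGSet.{u} G} (x y z : R.obj (Poly.of X)) : Prop :=
  ∃ v : R.obj (Poly.of (X.sum X)), R.map (Poly.R D (inl X X)) v = x ∧
    R.map (Poly.R D (inr X X)) v = y ∧ R.map (Poly.T D (fold X)) v = z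

/-- `z` is the zero element of `R(X)`: the image of the transfer `R(∅) → R(X)` from the one-point
set `R(∅)`. -/
def IsZero (R : Poly D ⥤ Type w) {X : FinGSet.{u} G} (z : R.obj (Poly.of X)) : Prop :=
  ∃ v : R.obj (Poly.of (FinGSet.empty G)), R.map (Poly.T D (fromEmpty X)) v = z

/-- The commutative monoids `R(X)` are abelian groups: every element has a negative. -/
def IsGroupValued (R : Poly D ⥤ Type w) : Prop :=
  ∀ (X : FinGSet.{u} G) (x : R.obj (Poly.of X)), ∃ y z, IsZero R z ∧ IsSum R x y z

/-- A functor on `P^G_D` is a `D`-Tambara functor if it preserves finite products and is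
(additively) group valued. -/
def isTambara (D : Exponents.{u} G) : ObjectProperty (Poly D ⥤ Type w) :=
  fun R => PreservesFiniteProducts R ∧ IsGroupValued R

/-- The category of `D`-Tambara functors. -/
abbrev Tambara (D : Exponents.{u} G) := (isTambara.{u, w} D).FullSubcategory

end Tambara

/-! ### Functors between categories of polynomials -/

/-- A functor from finite `G`-sets to finite `G'`-sets that maps `D` into `D'`, preserves the
composition of bispans (that is, pullbacks and dependent products) and finite disjoint unions. -/
structure PolyMap {G G' : Type u} [Group G] [Group G'] (D : Exponents.{u} G)
    (D' : Exponents.{u} G') where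
  obj : FinGSet.{u} G → FinGSet.{u} G'
  map : ∀ {X Y : FinGSet.{u} G}, (X →[G] Y) → (obj X →[G'] obj Y)
  map_id : ∀ X : FinGSet.{u} G, map (MulActionHom.id G : X →[G] X) = MulActionHom.id G'
  map_comp : ∀ {X Y Z : FinGSet.{u} G} (f : X →[G] Y) (g : Y →[G] Z),
    map (g.comp f) = (map g).comp (map f)
  map_mem : ∀ {X Y : FinGSet.{u} G} (f : X →[G] Y), D.mem f → D'.mem (map f)
  map_isComp : ∀ {X Y Z : FinGSet.{u} G} (p : Bispan X Y) (q : Bispan Y Z) (r : Bispan X Z),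
    Bispan.IsComp p q r → Nonempty (Bispan.IsComp
      (⟨obj p.A, obj p.B, map p.s, map p.f, map p.t⟩ : Bispan (obj X) (obj Y))
      (⟨obj q.A, obj q.B, map q.s, map q.f, map q.t⟩ : Bispan (obj Y) (obj Z))
      (⟨obj r.A, obj r.B, map r.s, map r.f, map r.t⟩ : Bispan (obj X) (obj Z)))
  map_isCoprod : ∀ {X Y Z : FinGSet.{u} G} (i : X →[G] Z) (j : Y →[G] Z), IsCoprod i j →
    IsCoprod (map i) (map j)
  map_empty : ∀ X : FinGSet.{u} G, IsEmpty X → IsEmpty (obj X)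

namespace PolyMap

variable {G G' : Type u} [Group G] [Group G'] {D : Exponents.{u} G} {D' : Exponents.{u} G'}
  (Φ : PolyMap D D')

/-- The image of the bispan `X ← A → B → Y` is `ΦX ← ΦA → ΦB → ΦY`. -/
def bispan {X Y : FinGSet.{u} G} (p : Bispan X Y) : Bispan (Φ.obj X) (Φ.obj Y) :=
  ⟨Φ.obj p.A, Φ.obj p.B, Φ.map p.s, Φ.map p.f, Φ.map p.t⟩

/-- The image of an equivariant bijection. -/
def equiv {X Y : FinGSet.{u} G} (e : X ≃ Y) (he : ∀ (g : G) (x : X), e (g • x) = g • e x) :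
    Φ.obj X ≃ Φ.obj Y where
  toFun := Φ.map ⟨e, he⟩
  invFun := Φ.map ⟨e.symm, fun g y => e.injective (by simp [he])⟩
  left_inv x := by
    have h : (⟨e.symm, fun g y => e.injective (by simp [he])⟩ : Y →[G] X).comp ⟨e, he⟩ =
        MulActionHom.id G := MulActionHom.ext fun x => e.symm_apply_apply x
    have := congrArg (fun f => f x) ((Φ.map_comp _ _).symm.trans ((congrArg Φ.map h).trans
      (Φ.map_id X)))
    exact this
  right_inv y := by
    have h : (⟨e, he⟩ : X →[G] Y).comp ⟨e.symm, fun g y => e.injective (by simp [he])⟩ =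
        MulActionHom.id G := MulActionHom.ext fun x => e.apply_symm_apply x
    have := congrArg (fun f => f y) ((Φ.map_comp _ _).symm.trans ((congrArg Φ.map h).trans
      (Φ.map_id Y)))
    exact this

theorem map_comm {X Y Z : FinGSet.{u} G} {f : X →[G] Y} {g : Y →[G] Z} {h : X →[G] Z}
    (hfg : ∀ x, g (f x) = h x) (x : Φ.obj X) : Φ.map g (Φ.map f x) = Φ.map h x := by
  rw [show h = g.comp f from MulActionHom.ext fun x => (hfg x).symm, Φ.map_comp]
  rfl

/-- The image of an isomorphism of bispans. -/
def iso {X Y : FinGSet.{u} G} {p q : Bispan X Y} (e : Bispan.Iso p q) :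
    Bispan.Iso (Φ.bispan p) (Φ.bispan q) where
  eA := Φ.equiv e.eA e.smul_A
  eB := Φ.equiv e.eB e.smul_B
  smul_A g a := map_smul (Φ.map ⟨e.eA, e.smul_A⟩) g a
  smul_B g a := map_smul (Φ.map ⟨e.eB, e.smul_B⟩) g a
  comm_s a := Φ.map_comm e.comm_s a
  comm_f a := (Φ.map_comm (h := q.f.comp ⟨e.eA, e.smul_A⟩) (fun _ => rfl) a).trans
    (Φ.map_comm (f := p.f) (g := ⟨e.eB, e.smul_B⟩) (fun a => (e.comm_f a).symm) a).symm
  comm_t a := Φ.map_comm e.comm_t a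

/-- The functor on polynomials. -/
def functor : Poly D ⥤ Poly D' where
  obj X := Poly.of (Φ.obj X.set)
  map {X Y} f := Quotient.map (sa := polySetoid D X.set Y.set)
    (sb := polySetoid D' (Φ.obj X.set) (Φ.obj Y.set))
    (fun p => ⟨Φ.bispan p.1, Φ.map_mem _ p.2⟩) (fun _ _ ⟨e⟩ => ⟨Φ.iso e⟩) f
  map_id X := by
    refine congrArg (Quotient.mk _) (Subtype.ext ?_)
    simp only [bispan, Bispan.id, Φ.map_id]
  map_comp f g := by
    obtain ⟨p, hp, rfl⟩ := PolyHom.exists_rep f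
    obtain ⟨q, hq, rfl⟩ := PolyHom.exists_rep g
    obtain ⟨h⟩ := Φ.map_isComp p q _ (Bispan.IsComp.ofComp p q)
    exact (PolyHom.comp_eq h (hp := Φ.map_mem _ hp) (hq := Φ.map_mem _ hq)
      (hr := Φ.map_mem _ (Bispan.comp_mem D p q hp hq))).symm

theorem functor_map_R {X Y : FinGSet.{u} G} (j : X →[G] Y) :
    Φ.functor.map (Poly.R D j) = Poly.R D' (Φ.map j) := by
  refine congrArg (Quotient.mk _) (Subtype.ext ?_)
  simp only [bispan, Bispan.R, Φ.map_id]

theorem functor_map_T {X Y : FinGSet.{u} G} (j : X →[G] Y) :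
    Φ.functor.map (Poly.T D j) = Poly.T D' (Φ.map j) := by
  refine congrArg (Quotient.mk _) (Subtype.ext ?_)
  simp only [bispan, Bispan.T, Φ.map_id]

instance preservesFiniteProducts : PreservesFiniteProducts Φ.functor := by
  have hb : ∀ X Y : Poly D, HasLimit (pair X Y) := fun X Y =>
    ⟨⟨_, Poly.isLimitFan (isCoprod_sum X.set Y.set)⟩⟩
  have : HasBinaryProducts (Poly D) := hasBinaryProducts_of_hasLimit_pair _
  have : HasTerminal (Poly D) := (Poly.isTerminal D (FinGSet.empty G)).hasTerminal
  have : HasFiniteProducts (Poly D) := hasFiniteProducts_of_has_binary_and_terminal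
  have h1 : ∀ X Y : Poly D, PreservesLimit (pair X Y) Φ.functor := fun X Y => by
    refine preservesLimit_of_preserves_limit_cone (Poly.isLimitFan (isCoprod_sum X.set Y.set)) ?_
    refine (isLimitMapConeBinaryFanEquiv _ _ _).symm ?_
    rw [functor_map_R, functor_map_R]
    exact Poly.isLimitFan (Φ.map_isCoprod _ _ (isCoprod_sum X.set Y.set))
  have h2 : PreservesLimitsOfShape (Discrete WalkingPair) Φ.functor :=
    ⟨fun {K} => preservesLimit_of_iso_diagram _ (diagramIsoPair K).symm⟩
  have h3 : PreservesLimit (Functor.empty.{0} (Poly D)) Φ.functor := by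
    refine preservesLimit_of_preserves_limit_cone (Poly.isTerminal D (FinGSet.empty G)) ?_
    refine (isLimitMapConeEmptyConeEquiv _ _).symm ?_
    have := Φ.map_empty (FinGSet.empty G) inferInstance
    exact Poly.isTerminal D' (Φ.obj (FinGSet.empty G))
  have h4 := preservesLimitsOfShape_pempty_of_preservesTerminal Φ.functor
  exact PreservesFiniteProducts.of_preserves_binary_and_terminal Φ.functor

theorem map_map_apply {C : Type*} [Category C] (R : C ⥤ Type w) {X Y Z : C} {f : X ⟶ Y} {g : Y ⟶ Z}
    {h : X ⟶ Z} (hfg : f ≫ g = h) (v : R.obj X) : R.map g (R.map f v) = R.map h v := by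
  rw [← hfg, R.map_comp]
  rfl

theorem isGroupValued {R : Poly D' ⥤ Type w} (hR : IsGroupValued R) :
    IsGroupValued (Φ.functor ⋙ R) := by
  intro X x
  obtain ⟨y, z, ⟨v₀, hv₀⟩, v, hv1, hv2, hv3⟩ := hR (Φ.obj X) x
  have hco := Φ.map_isCoprod _ _ (isCoprod_sum X X)
  have e0 : Poly.T D' (fromEmpty (Φ.obj (FinGSet.empty G))) ≫ Poly.T D' (Φ.map (fromEmpty X)) =
      Poly.T D' (fromEmpty (Φ.obj X)) := by
    rw [Poly.T_comp_T]
    congr 1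
    exact MulActionHom.ext fun a => isEmptyElim a
  have e1 : Poly.T D' (desc (Φ.map (inl X X)) (Φ.map (inr X X))) ≫ Poly.R D' (Φ.map (inl X X)) =
      Poly.R D' (inl (Φ.obj X) (Φ.obj X)) :=
    Poly.comp_R.2 ⟨⟨inl _ _, inl _ _, fun _ => rfl, fun _ => rfl, fun _ => rfl,
      fun b x' hb => ⟨x', hco.1 hb.symm, rfl⟩, fun _ _ _ h => h, fun a b h => ⟨b, h.symm, rfl⟩,
      fun _ _ _ h => h⟩⟩
  have e2 : Poly.T D' (desc (Φ.map (inl X X)) (Φ.map (inr X X))) ≫ Poly.R D' (Φ.map (inr X X)) =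
      Poly.R D' (inr (Φ.obj X) (Φ.obj X)) :=
    Poly.comp_R.2 ⟨⟨inr _ _, inr _ _, fun _ => rfl, fun _ => rfl, fun _ => rfl,
      fun b x' hb => ⟨x', hco.1 hb.symm, rfl⟩, fun _ _ _ h => h, fun a b h => ⟨b, h.symm, rfl⟩,
      fun _ _ _ h => h⟩⟩
  have e3 : Poly.T D' (desc (Φ.map (inl X X)) (Φ.map (inr X X))) ≫ Poly.T D' (Φ.map (fold X)) =
      Poly.T D' (fold (Φ.obj X)) := by
    rw [Poly.T_comp_T]
    congr 1
    refine MulActionHom.ext ?_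
    rintro (a | a)
    · refine (Φ.map_comm (f := inl X X) (g := fold X) (h := MulActionHom.id G) (fun _ => rfl)
        a).trans ?_
      rw [Φ.map_id]
      rfl
    · refine (Φ.map_comm (f := inr X X) (g := fold X) (h := MulActionHom.id G) (fun _ => rfl)
        a).trans ?_
      rw [Φ.map_id]
      rfl
  refine ⟨y, z, ⟨R.map (Poly.T D' (fromEmpty (Φ.obj (FinGSet.empty G)))) v₀, ?_⟩,
    R.map (Poly.T D' (desc (Φ.map (inl X X)) (Φ.map (inr X X)))) v, ?_, ?_, ?_⟩
  · rw [Functor.comp_map, functor_map_T]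
    exact (map_map_apply R e0 v₀).trans hv₀
  · rw [Functor.comp_map, functor_map_R]
    exact (map_map_apply R e1 v).trans hv1
  · rw [Functor.comp_map, functor_map_R]
    exact (map_map_apply R e2 v).trans hv2
  · rw [Functor.comp_map, functor_map_T]
    exact (map_map_apply R e3 v).trans hv3

/-- Precomposition with the functor on polynomials, as a functor between categories of Tambara
functors. -/
def precomp : Tambara.{u, w} D' ⥤ Tambara.{u, w} D :=
  (isTambara D).lift ((isTambara D').ι ⋙ (Functor.whiskeringLeft _ _ _).obj Φ.functor) (fun R => by
    have := R.property.1
    refine ⟨?_, Φ.isGroupValued R.property.2⟩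
    change PreservesFiniteProducts (Φ.functor ⋙ R.obj)
    infer_instance)

end PolyMap

/-! ### Change of groups -/

section ChangeOfGroups

open MulAction

variable {G : Type u} [Group G] (H : Subgroup G)

theorem conj_mem_map_stabilizer [Finite G] {X : FinGSet.{u} H} (g : G) (x : X) (l : G) :
    l ∈ stabilizer G (ind.mk H.subtype g x) ↔
      g⁻¹ * l * g ∈ (stabilizer H x).map H.subtype := by
  rw [mem_stabilizer_iff, ind.smul_mk, ind.mk_eq]
  constructor
  · rintro ⟨k, h1, h2⟩
    exact ⟨k, h2.symm, by rw [mul_assoc, h1]; simp⟩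
  · rintro ⟨k, h1, h2⟩
    refine ⟨k, ?_, h1.symm⟩
    rw [h2]
    simp [mul_assoc]

theorem mem_map_stabilizer {X : FinGSet.{u} G} (x : X) (l : G) :
    l ∈ (stabilizer H (show X.pull H.subtype from x)).map H.subtype ↔
      l ∈ H ∧ l ∈ stabilizer G x := by
  constructor
  · rintro ⟨k, h1, rfl⟩
    exact ⟨k.2, h1⟩
  · rintro ⟨h1, h2⟩
    exact ⟨⟨l, h1⟩, h2, rfl⟩

variable [Finite G]

/-- Restriction `T ↦ i_H^* T` from finite `G`-sets to finite `H`-sets. -/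
def resPolyMap (O : IndexingSystem G) (H : Subgroup G) : PolyMap O.exponents (O.res H).exponents where
  obj T := T.pull H.subtype
  map f := pullMap H.subtype f
  map_id _ := rfl
  map_comp _ _ := rfl
  map_mem {X Y} f hf x := by
    rw [IndexingSystem.res_adm_quot]
    have h1 := mem_map_stabilizer H (X := Y) (f x)
    have h2 := mem_map_stabilizer H (X := X) x
    refine O.adm_quot 1 (fun l hl => ?_) (fun l hl => ?_) (hf x)
    · simpa using ((h1 l).1 hl).2
    · simp only [inv_one, one_mul, mul_one]
      exact (h2 l).trans (and_iff_right ((h1 l).1 hl).1)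
  map_isComp p q r h := ⟨
    { δ := pullMap H.subtype h.δ
      E := h.E
      π := pullMap H.subtype h.π
      ρ := pullMap H.subtype h.ρ
      E_smul := fun g => h.E_smul (g : G)
      E_dom := h.E_dom
      E_t := h.E_t
      E_total := h.E_total
      E_unique := h.E_unique
      exists_B := h.exists_B
      ext_B := h.ext_B
      comm_t := h.comm_t
      comm_s := h.comm_s
      E_A := h.E_A
      exists_A := h.exists_A
      ext_A := h.ext_A }⟩
  map_isCoprod i j hij := hij
  map_empty _ h := h

variable {H} in
/-- The relation on induced sets that corresponds to a relation on `H`-sets. -/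
def indRel {B C X : FinGSet.{u} H} (E : B → C → X → Prop) (b' : B.ind H.subtype)
    (c' : C.ind H.subtype) (x' : X.ind H.subtype) : Prop :=
  ∃ l b c x, b' = ind.mk H.subtype l b ∧ c' = ind.mk H.subtype l c ∧
    x' = ind.mk H.subtype l x ∧ E b c x

variable {H} in
theorem indRel_mk {B C X : FinGSet.{u} H} {E : B → C → X → Prop}
    (hE : ∀ (g : H) b c x, E b c x → E (g • b) (g • c) (g • x)) {l : G} {b : B}
    {c' : C.ind H.subtype} {x' : X.ind H.subtype}
    (h : indRel E (ind.mk H.subtype l b) c' x') :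
    ∃ c x, c' = ind.mk H.subtype l c ∧ x' = ind.mk H.subtype l x ∧ E b c x := by
  obtain ⟨l', b', c, x, h1, rfl, rfl, h2⟩ := h
  obtain ⟨k, rfl, rfl⟩ := (ind.mk_eq _).1 h1.symm
  exact ⟨k • c, k • x, ind.mk_mul _ _ _ _, ind.mk_mul _ _ _ _, hE _ _ _ _ h2⟩

/-- Induction `T ↦ G ×_H T` from finite `H`-sets to finite `G`-sets. -/
def indPolyMap (O : IndexingSystem G) (H : Subgroup G) : PolyMap (O.res H).exponents O.exponents where
  obj T := T.ind H.subtype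
  map f := indMap H.subtype f
  map_id X := by
    refine MulActionHom.ext fun x => ?_
    obtain ⟨l, t, rfl⟩ := ind.ind_mk _ x
    rfl
  map_comp f g := by
    refine MulActionHom.ext fun x => ?_
    obtain ⟨l, t, rfl⟩ := ind.ind_mk _ x
    rfl
  map_mem {X Y} f hf x := by
    obtain ⟨g, x, rfl⟩ := ind.ind_mk _ x
    have h := hf x
    rw [IndexingSystem.res_adm_quot] at h
    exact O.adm_quot g (fun l hl => (conj_mem_map_stabilizer H g (f x) l).1 hl)
      (fun l _ => conj_mem_map_stabilizer H g x l) h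
  map_isComp {X Y Z} p q r h := ⟨by
    have hinj : Function.Injective H.subtype := H.subtype_injective
    refine
    { δ := indMap H.subtype h.δ
      E := indRel h.E
      π := indMap H.subtype h.π
      ρ := indMap H.subtype h.ρ
      E_smul := ?_
      E_dom := ?_
      E_t := ?_
      E_total := ?_
      E_unique := ?_
      exists_B := ?_
      ext_B := ?_
      comm_t := ?_
      comm_s := ?_
      E_A := ?_
      exists_A := ?_
      ext_A := ?_ }
    · rintro g _ _ _ ⟨l, b, c, x, rfl, rfl, rfl, h1⟩
      exact ⟨g * l, b, c, x, rfl, rfl, rfl, h1⟩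
    · rintro _ _ _ ⟨l, b, c, x, rfl, rfl, rfl, h1⟩
      exact congrArg (ind.mk H.subtype l) (h.E_dom _ _ _ h1)
    · rintro _ _ _ ⟨l, b, c, x, rfl, rfl, rfl, h1⟩
      exact congrArg (ind.mk H.subtype l) (h.E_t _ _ _ h1)
    · intro b' c' hbc
      obtain ⟨l, b, rfl⟩ := ind.ind_mk _ b'
      obtain ⟨c, rfl, hc⟩ := ind.exists_of_map_eq hbc
      obtain ⟨x, hx⟩ := h.E_total b c hc
      exact ⟨ind.mk _ l x, l, b, c, x, rfl, rfl, rfl, hx⟩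
    · intro b' c' x₁' x₂' h1 h2
      obtain ⟨l, b, rfl⟩ := ind.ind_mk _ b'
      obtain ⟨c₁, x₁, rfl, rfl, h3⟩ := indRel_mk h.E_smul h1
      obtain ⟨c₂, x₂, h4, rfl, h5⟩ := indRel_mk h.E_smul h2
      obtain rfl := (ind.mk_inj hinj).1 h4
      rw [h.E_unique _ _ _ _ h3 h5]
    · intro d' σ hσ
      obtain ⟨l, d, rfl⟩ := ind.ind_mk _ d'
      have hc : ∀ c, q.f c = d → indMap H.subtype q.f (ind.mk H.subtype l c) =
          ind.mk H.subtype l d := fun c hc => congrArg (ind.mk H.subtype l) hc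
      have hτ : ∀ c (hcd : q.f c = d), ∃ x, σ (ind.mk H.subtype l c) (hc c hcd) =
          ind.mk H.subtype l x ∧ p.t x = q.s c := fun c hcd =>
        ind.exists_of_map_eq (hσ _ (hc c hcd))
      choose τ hτ1 hτ2 using hτ
      obtain ⟨b, rfl, hb⟩ := h.exists_B d τ hτ2
      refine ⟨ind.mk _ l b, rfl, fun c' hc' => ?_⟩
      obtain ⟨c, rfl, hcd⟩ := ind.exists_of_map_eq hc'
      exact ⟨l, b, c, τ c hcd, rfl, rfl, hτ1 c hcd, hb c hcd⟩
    · intro b₁' b₂' h1 h2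
      obtain ⟨l, b₁, rfl⟩ := ind.ind_mk _ b₁'
      obtain ⟨b₂, rfl, h3⟩ := ind.exists_of_map_eq h1.symm
      refine congrArg (ind.mk _ l) (h.ext_B _ _ h3.symm fun c x hx => ?_)
      obtain ⟨c', x', h4, h5, h6⟩ := indRel_mk h.E_smul
        (h2 _ _ ⟨l, b₁, c, x, rfl, rfl, rfl, hx⟩)
      rwa [(ind.mk_inj hinj).1 h4, (ind.mk_inj hinj).1 h5]
    · intro b'
      obtain ⟨l, b, rfl⟩ := ind.ind_mk _ b'
      exact congrArg (ind.mk _ l) (h.comm_t b)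
    · intro a'
      obtain ⟨l, a, rfl⟩ := ind.ind_mk _ a'
      exact congrArg (ind.mk _ l) (h.comm_s a)
    · intro a'
      obtain ⟨l, a, rfl⟩ := ind.ind_mk _ a'
      exact ⟨l, _, _, _, rfl, rfl, rfl, h.E_A a⟩
    · intro b' c' a' h1
      obtain ⟨l, b, rfl⟩ := ind.ind_mk _ b'
      obtain ⟨c, x, rfl, h2, h3⟩ := indRel_mk h.E_smul h1
      obtain ⟨a, rfl, rfl⟩ := ind.exists_of_map_eq h2
      obtain ⟨a₁, rfl, rfl, rfl⟩ := h.exists_A _ _ _ h3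
      exact ⟨ind.mk _ l a₁, rfl, rfl, rfl⟩
    · intro a₁' a₂' h1 h2 h3
      obtain ⟨l, a₁, rfl⟩ := ind.ind_mk _ a₁'
      obtain ⟨a₂, rfl, h4⟩ := ind.exists_of_map_eq h1.symm
      exact congrArg (ind.mk _ l) (h.ext_A _ _ h4.symm ((ind.mk_inj hinj).1 h2)
        ((ind.mk_inj hinj).1 h3))⟩
  map_isCoprod {X Y Z} i j hij := by
    have hinj : Function.Injective H.subtype := H.subtype_injective
    constructor
    · rintro (x' | x') (y' | y') hxy
      · obtain ⟨l, y, rfl⟩ := ind.ind_mk _ y'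
        obtain ⟨x, rfl, hx⟩ := ind.exists_of_map_eq (f := i) hxy
        rw [Bispan.inl_inj hij hx]
      · obtain ⟨l, y, rfl⟩ := ind.ind_mk _ y'
        obtain ⟨x, rfl, hx⟩ := ind.exists_of_map_eq (f := i) hxy
        exact (Bispan.inl_ne_inr hij hx).elim
      · obtain ⟨l, y, rfl⟩ := ind.ind_mk _ y'
        obtain ⟨x, rfl, hx⟩ := ind.exists_of_map_eq (f := j) hxy
        exact (Bispan.inl_ne_inr hij hx.symm).elim
      · obtain ⟨l, y, rfl⟩ := ind.ind_mk _ y'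
        obtain ⟨x, rfl, hx⟩ := ind.exists_of_map_eq (f := j) hxy
        rw [Bispan.inr_inj hij hx]
    · intro z'
      obtain ⟨l, z, rfl⟩ := ind.ind_mk _ z'
      obtain ⟨x | y, rfl⟩ := hij.2 z
      · exact ⟨Sum.inl (ind.mk _ l x), rfl⟩
      · exact ⟨Sum.inr (ind.mk _ l y), rfl⟩
  map_empty X h := ⟨fun x => by
    obtain ⟨l, t, rfl⟩ := ind.ind_mk _ x
    exact h.elim t⟩

/-- The restriction functor `i_H^*` from `O`-Tambara functors for `G` to `i_H^* O`-Tambara functors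
for `H`: precomposition with induction, `(i_H^* R)(T) = R(G ×_H T)`. -/
noncomputable def restrictTambara (O : IndexingSystem G) (H : Subgroup G) :
    Tambara.{u, w} O.exponents ⥤ Tambara.{u, w} (O.res H).exponents :=
  (indPolyMap O H).precomp

/-- The coinduction functor from `i_H^* O`-Tambara functors for `H` to `O`-Tambara functors for `G`:
precomposition with restriction, `(CoInd R)(T) = R(i_H^* T)`. -/
noncomputable def coinduceTambara (O : IndexingSystem G) (H : Subgroup G) :
    Tambara.{u, w} (O.res H).exponents ⥤ Tambara.{u, w} O.exponents :=
  (resPolyMap O H).precomp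

end ChangeOfGroups

end IncompleteTambara

/-! The theorem is a formal consequence of an adjunction between the categories of polynomials. On
finite sets induction is left adjoint to restriction, with counit `ε : G ×_H X → X`, `[l, x] ↦ l x`,
and unit `η : X → G ×_H X`, `x ↦ [1, x]`. The assignment `j ↦ R_j` is contravariant, so on
polynomials the handedness flips: `R_ε : X ⟶ Ind Res X` is the unit and `R_η : Res Ind X ⟶ X` the
counit of an adjunction in which restriction is the left adjoint (`resIndAdjunction`). The triangle
identities are those of sets with the arrows reversed.

The content is that `R_ε` and `R_η` are natural with respect to all bispans `X ← A → B → Y`, hence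
with respect to norms and transfers as well as restrictions. Precomposing a bispan with some `R_j`
only changes its source leg (`Poly.R_comp`), while postcomposing with `R_i` pulls `B`, and then `A`,
back along `i` (`Poly.comp_R`). Naturality therefore needs the naturality squares of `ε` and `η` to
be pullbacks at `B → Y` and `A → B`, and merely to commute at `A → X`. They are pullbacks at every
map: `ε` is, up to isomorphism, the projection `G/H × X → X`, and `η` is the inclusion of the fibre
of `G ×_H X → G/H` over the trivial coset. The lemmas `indPullCounit_exists`, `indPullCounit_ext`,
`pullIndUnit_exists` and `pullIndUnit_injective` express this in terms of elements.

Precomposition reverses an adjunction: from restriction ⊣ induction on polynomials, precomposition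
with induction, which is `i_H^*`, becomes left adjoint to precomposition with restriction, which is
coinduction. No Kan extension has to be computed. Both functors preserve Tambara functors, so the
adjunction passes to the full subcategories. The bispans `R_j` have an identity as middle map and so
lie in the category for every `O`; admissibility enters only in that restriction and induction are
functors on polynomials. -/

namespace IncompleteTambara

/-! ### Composition with restriction maps `R_j`. -/

namespace Bispan

variable {G : Type u} [Group G] {X Y Z : FinGSet.{u} G}

/-- The composite of `R_j` and `p`. -/
def rComp (j : X →[G] Y) (p : Bispan X Z) : Bispan Y Z := ⟨p.A, p.B, j.comp p.s, p.f, p.t⟩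

/-- The composite of `R_j` and `p` is obtained by composing the source leg of `p` with `j`. -/
def isCompR (j : X →[G] Y) (p : Bispan X Z) : IsComp (R j) p (rComp j p) where
  δ := MulActionHom.id G
  -- The middle and target maps of `R_j` are identities, so the pullback along `p.s` has exactly one
  -- point over each `c`, namely `p.s c`. Its dependent product along `p.f` is thus `p.B` itself,
  -- and evaluation at `c` returns `p.s c`.
  E b c x := p.f c = b ∧ x = p.s c
  π := MulActionHom.id G
  ρ := p.s
  E_smul := by
    rintro g _ c _ ⟨rfl, rfl⟩
    exact ⟨map_smul _ _ _, (map_smul _ _ _).symm⟩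
  E_dom := by
    rintro _ c _ ⟨rfl, rfl⟩
    rfl
  E_t := by
    rintro _ c _ ⟨rfl, rfl⟩
    rfl
  E_total b c h := ⟨_, h, rfl⟩
  E_unique := by
    rintro b c _ _ ⟨_, rfl⟩ ⟨_, rfl⟩
    rfl
  exists_B d σ hσ := ⟨d, rfl, fun c h => ⟨h, hσ c h⟩⟩
  ext_B b b' h _ := h
  comm_t b := rfl
  comm_s a := rfl
  E_A a := ⟨rfl, rfl⟩
  exists_A b c a h := ⟨c, h.1, rfl, h.2.symm⟩
  ext_A a a' _ h _ := h

end Bispan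

namespace Poly

variable {G : Type u} [Group G] {D : Exponents.{u} G} {X Y Z : FinGSet.{u} G}

/-- Computes one side of each naturality square below: no dependent product survives, and the class
of exponents plays no role beyond `hp`. -/
theorem R_comp (j : X →[G] Y) (p : Bispan X Z) (hp : D.mem p.f) :
    (R D j).comp (PolyHom.mk p hp) = PolyHom.mk (Bispan.rComp j p) hp :=
  PolyHom.comp_eq (Bispan.isCompR j p)

/-- Contravariant functoriality of `R`. It turns the triangle identities for polynomials into
identities between equivariant maps. -/
theorem R_comp_R (i : Y →[G] Z) (j : X →[G] Y) : R D i ≫ R D j = R D (i.comp j) :=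
  R_comp i (Bispan.R j) (D.id_mem X)

theorem R_id (X : FinGSet.{u} G) : R D (MulActionHom.id G : X →[G] X) = 𝟙 (Poly.of X) := rfl

end Poly

/-! ### Unit and counit of induction and restriction on finite sets, and their pullback squares. -/

namespace FinGSet

variable {G : Type u} [Group G] [Finite G] (H : Subgroup G)

/-- The action map `G ×_H X → X`. -/
def indPullCounit (X : FinGSet.{u} G) : (X.pull H.subtype).ind H.subtype →[G] X where
  -- Under `G ×_H X ≅ G/H × X`, `[l, x] ↦ (lH, l x)`, this is the second projection.
  toFun := Quotient.lift (fun x : G × X => x.1 • x.2) (by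
    rintro ⟨l, x⟩ ⟨l', x'⟩ ⟨k, h1, h2⟩
    obtain rfl : l = l' * k := h1
    -- The restricted set has the same points as `X` but only carries an action of `H`; the
    -- ascription makes the action of `G` available.
    obtain rfl : x' = (k : G) • (show X.carrier from x) := h2
    exact mul_smul l' (k : G) (show X.carrier from x))
  map_smul' := by
    rintro g ⟨l, x⟩
    exact mul_smul g l (show X.carrier from x)

/-- On `[l, x]` this is `l (f x) = f (l x)`, which uses equivariance under all of `G`. It gives the
commutativity conditions for all three legs of a bispan in `resIndUnit`. -/
theorem indPullCounit_naturality {X Y : FinGSet.{u} G} (f : X →[G] Y)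
    (x : (X.pull H.subtype).ind H.subtype) :
    indPullCounit H Y (indMap H.subtype (pullMap H.subtype f) x) = f (indPullCounit H X x) := by
  obtain ⟨l, x, rfl⟩ := ind.ind_mk _ x
  exact (map_smul f l (show X.carrier from x)).symm

/-- Existence half of the claim that the naturality square of the action map at `f` is a pullback: a
point of `G ×_H X` amounts to a coset and a point of `X`, and the coset can be read off in `G ×_H
Y`. -/
theorem indPullCounit_exists {X Y : FinGSet.{u} G} (f : X →[G] Y) (x : X)
    (y : (Y.pull H.subtype).ind H.subtype) (h : f x = indPullCounit H Y y) :
    ∃ x', indPullCounit H X x' = x ∧ indMap H.subtype (pullMap H.subtype f) x' = y := by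
  obtain ⟨l, y, rfl⟩ := ind.ind_mk _ y
  -- A lift of `[l, y]` can be sought as `[l, z]`; the condition `l z = x` then forces `z = l⁻¹ x`.
  -- It remains that `f (l⁻¹ x) = l⁻¹ (l y) = y`.
  refine ⟨ind.mk (T := X.pull H.subtype) H.subtype l (l⁻¹ • x : X), smul_inv_smul l x, ?_⟩
  refine congrArg (ind.mk (T := Y.pull H.subtype) H.subtype l) ?_
  refine (map_smul f l⁻¹ x).trans ?_
  rw [h]
  exact inv_smul_smul l (show Y.carrier from y)

/-- Uniqueness half of the same pullback. The action map alone is not injective in general;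
agreement in `G ×_H Y` supplies the missing information, that both points lie over the same coset.
-/
theorem indPullCounit_ext {X Y : FinGSet.{u} G} (f : X →[G] Y)
    (x x' : (X.pull H.subtype).ind H.subtype) (h : indPullCounit H X x = indPullCounit H X x')
    (h' : indMap H.subtype (pullMap H.subtype f) x = indMap H.subtype (pullMap H.subtype f) x') :
    x = x' := by
  obtain ⟨l, x', rfl⟩ := ind.ind_mk _ x'
  -- Since the images agree, the first point also has a representative with group coordinate `l`.
  -- After that, `l x = l x'` can be cancelled.
  obtain ⟨x, rfl, -⟩ := ind.exists_of_map_eq h'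
  exact congrArg (ind.mk (T := X.pull H.subtype) H.subtype l)
    ((smul_left_cancel_iff (α := G) (β := X) l).1 h)

/-- The inclusion `X → G ×_H X`, `x ↦ (1, x)`. -/
def pullIndUnit (X : FinGSet.{u} H) : X →[H] (X.ind H.subtype).pull H.subtype where
  toFun x := ind.mk H.subtype 1 x
  map_smul' k x := by
    refine (ind.mk_mul H.subtype 1 k x).symm.trans ?_
    -- The action multiplies the group coordinate on the left, so `k • [1, x]` is literally `[k * 1,
    -- x]`, whereas the relation has produced `[1 * k, x]`.
    rw [one_mul, ← mul_one (H.subtype k)]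
    rfl

/-- Existence half of the pullback property for the inclusions: a map of the form `indMap` preserves
the coset, so a point lying over some `[1, y]` is itself in the fibre over the trivial coset. -/
theorem pullIndUnit_exists {X Y : FinGSet.{u} H} (f : X →[H] Y) (x : X.ind H.subtype) (y : Y)
    (h : indMap H.subtype f x = ind.mk H.subtype 1 y) :
    ∃ x', pullIndUnit H X x' = x ∧ f x' = y := by
  obtain ⟨x', rfl, hx⟩ := ind.exists_of_map_eq h
  exact ⟨x', rfl, hx⟩

/-- If `[1, x] = [1, x']`, the element of `H` relating the representatives must be `1`. This is the
uniqueness half of the pullback property, and here the comparison after applying `f` is superfluous.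
-/
theorem pullIndUnit_injective (X : FinGSet.{u} H) : Function.Injective (pullIndUnit H X) :=
  fun _ _ h => (ind.mk_inj H.subtype_injective).1 h

end FinGSet

open FinGSet

/-! ### The adjunction on polynomials, and its transfer to Tambara functors. -/

section Adjunction

variable {G : Type u} [Group G] [Finite G] (O : IndexingSystem G) (H : Subgroup G)

/-- The unit of the adjunction between restriction and induction of polynomials: the restriction
maps along the action maps `G ×_H X → X`. -/
noncomputable def resIndUnit : 𝟭 (Poly O.exponents) ⟶ (resPolyMap O H).functor ⋙ (indPolyMap O H).functor where
  app X := Poly.R O.exponents (indPullCounit H X.set)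
  naturality X Y f := by
    obtain ⟨p, hp, rfl⟩ := PolyHom.exists_rep f
    -- The right-hand composite is the induced restriction of `p` with its source leg prolonged by
    -- the action map. It has to be identified with the part of `p` over the action map at the
    -- target.
    refine (Poly.comp_R.2 ⟨?_⟩).trans (Poly.R_comp (indPullCounit H X.set)
      ((indPolyMap O H).bispan ((resPolyMap O H).bispan p))
      ((indPolyMap O H).map_mem _ ((resPolyMap O H).map_mem _ hp))).symm
    exact
      { α := indPullCounit H p.A
        β := indPullCounit H p.B
        comm_t := fun b => (indPullCounit_naturality H p.t b).symm
        comm_f := fun a => (indPullCounit_naturality H p.f a).symm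
        comm_s := fun a => (indPullCounit_naturality H p.s a).symm
        -- The pullback property is used twice, at `p.t` to identify the pullback of `p.B` and at
        -- `p.f` to identify that of `p.A`. The leg `p.s` only has to commute.
        exists_B := indPullCounit_exists H p.t
        ext_B := indPullCounit_ext H p.t
        exists_A := indPullCounit_exists H p.f
        ext_A := indPullCounit_ext H p.f }

/-- The counit of the adjunction between restriction and induction of polynomials: the restriction
maps along the inclusions `X → G ×_H X`. -/
noncomputable def resIndCounit :
    (indPolyMap O H).functor ⋙ (resPolyMap O H).functor ⟶ 𝟭 (Poly (O.res H).exponents) where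
  app X := Poly.R (O.res H).exponents (pullIndUnit H X.set)
  naturality X Y f := by
    obtain ⟨p, hp, rfl⟩ := PolyHom.exists_rep f
    -- Same comparison with the roles exchanged: the bispan cut down is now the restriction of the
    -- induction of `p`, and its part over the trivial coset is `p`, with source leg prolonged by
    -- the inclusion.
    refine (Poly.comp_R (m := (resPolyMap O H).bispan ((indPolyMap O H).bispan p))
      (hm := (resPolyMap O H).map_mem _ ((indPolyMap O H).map_mem _ hp)).2 ⟨?_⟩).trans
      (Poly.R_comp (pullIndUnit H X.set) p hp).symm
    exact
      { α := pullIndUnit H p.A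
        β := pullIndUnit H p.B
        comm_t := fun _ => rfl
        comm_f := fun _ => rfl
        comm_s := fun _ => rfl
        exists_B := pullIndUnit_exists H p.t
        ext_B := fun _ _ h _ => pullIndUnit_injective H _ h
        exists_A := pullIndUnit_exists H p.f
        ext_A := fun _ _ h _ => pullIndUnit_injective H _ h }

/-- On polynomials, restriction is left adjoint to induction. -/
noncomputable def resIndAdjunction : (resPolyMap O H).functor ⊣ (indPolyMap O H).functor where
  unit := resIndUnit O H
  counit := resIndCounit O H
  left_triangle_components X := by
    -- Restriction functors on polynomials carry `R_j` to the `R` of the restricted map, so the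
    -- composite is `R` of `x ↦ [1, x] ↦ 1 x`. On sets this is the triangle identity on the
    -- restriction side, the right one there.
    refine (congrArg (· ≫ Poly.R (O.res H).exponents (pullIndUnit H (X.set.pull H.subtype)))
      ((resPolyMap O H).functor_map_R (indPullCounit H X.set))).trans
      ((Poly.R_comp_R _ _).trans ?_)
    refine (congrArg (Poly.R _) (MulActionHom.ext fun x => ?_)).trans (Poly.R_id _)
    exact one_smul G (show X.set.carrier from x)
  right_triangle_components X := by
    -- Here the composite is `R` of `[l, x] ↦ [l, [1, x]] ↦ l [1, x] = [l * 1, x]`, the triangle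
    -- identity on the induction side.
    refine (congrArg (Poly.R O.exponents (indPullCounit H (X.set.ind H.subtype)) ≫ ·)
      ((indPolyMap O H).functor_map_R (pullIndUnit H X.set))).trans
      ((Poly.R_comp_R _ _).trans ?_)
    refine (congrArg (Poly.R _) (MulActionHom.ext fun x => ?_)).trans (Poly.R_id _)
    obtain ⟨l, x, rfl⟩ := ind.ind_mk _ x
    exact congrArg (fun g => ind.mk H.subtype g x) (mul_one l)

/-- Restriction of Tambara functors is left adjoint to coinduction. -/
noncomputable def restrictCoinduceAdjunction :
    restrictTambara.{u, w} O H ⊣ coinduceTambara.{u, w} O H :=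
  -- Whiskering exchanges the two sides: precomposition with the right adjoint (induction) becomes
  -- the left adjoint. The comparison isomorphisms are identities, because `precomp` is
  -- precomposition followed by the observation that the result is again a Tambara functor.
  ((resIndAdjunction O H).whiskerLeft (Type w)).restrictFullyFaithful
    (isTambara O.exponents).fullyFaithfulι (isTambara (O.res H).exponents).fullyFaithfulι
    (Iso.refl _) (Iso.refl _)

end Adjunction

end IncompleteTambara

/-! ### The main theorem. -/

open IncompleteTambara in
theorem mainTheorem5 {G : Type u} [Group G] [Finite G] (O : IndexingSystem G) (H : Subgroup G) :
    Nonempty (restrictTambara.{u, w} O H ⊣ coinduceTambara.{u, w} O H) ∧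
    ∀ (R : Tambara.{u, w} (O.res H).exponents) (T : FinGSet.{u} G),
      ((coinduceTambara.{u, w} O H).obj R).obj.obj (Poly.of T) =
        R.obj.obj (Poly.of (T.pull H.subtype)) :=
  -- The formula for the values of coinduction is definitional, coinduction being precomposition
  -- with restriction.
  ⟨⟨restrictCoinduceAdjunction O H⟩, fun _ _ => rfl⟩
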